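/- **Setting.** Let $\alpha\in(0,1)$ be a fixed restart probability. Let $\mathcal G=(V,E,w)$ be a directed graph with positive edge weights, $n=|V|\ge 1$, $m=|E|$, out-degrees $d_i=\sum_{j:(i,j)\in E}w(i,j)$, $d_{\max}=\max_i d_i$, $p_{ij}=w(i,j)/d_i$ for $(i,j)\in E$, and let $S\subseteq V$. An *edge rewiring* $(i,j,k)$, where $(i,j)\in E$, $(i,k)\notin E$ and $i\neq k$, replaces the edge $(i,j)$ by $(i,k)$ with the same weight. In the unit-cost real-RAM model (graph stored by adjacency lists, $O(1)$ per call of a random number or of a random out-neighbour), $\textsc{RandomForest}$ samples a rooted spanning forest by Wilson's loop-erased random walks: for each node in turn, walk from it until a node already in the forest is reached, where at a node $u$ the walk stops and makes $u$ a root with probability $1/(1+d_u)$, and otherwise moves to an out-neighbour $v$ of $u$ with probability $p_{uv}$; the loop-erased walk is then added to the forest. **Algorithm** $\textsc{Fast}(\mathcal G,b,S,\psi)$. Start with the empty list $R$ and repeat $b$ times: (1) build the reweighted graph $\mathcal G_r$ with the same edges and with $w_r(i,j)=\frac{w(i,j)}{(\alpha/(1-\alpha))\,d_i}$; (2) sample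 $\psi$ independent forests $F_1,\dots,F_\psi$ by $\textsc{RandomForest}(\mathcal G_r)$ and set $\sigma'_s=\frac1{n\psi}\sum_{t}|\{u: s \text{ is the root of } u \text{ in } F_t\}|$ and $\eta'_s=\frac1\psi|\{t:\text{the root of } s \text{ in } F_t \text{ lies in } S\}|$; (3) let $K$ be a set of $\min(n,\lceil d_{\max}\rceil)$ nodes with the largest values of $\eta'$; (4) among all edge rewirings $(i,j,k)$ of the current graph with $k\in K$, by going through all edges and all nodes of $K$, pick one that maximizes the estimated ($\tau$-free) PageRank fairness gain $\widehat\Delta'((i,j,k),S)=(1-\alpha)\,p_{ij}\,\sigma'_i\,(\eta'_k-\eta'_j)$, append it to $R$ and perform it on $\mathcal G$ (if there is no such rewiring, the round selects nothing). **Theorem.** Let $b\ge1$, $\varepsilon>0$, $\delta\in(0,1)$ and $\psi=\left\lceil\frac{1}{2\varepsilon^2}\ln\frac2\delta\right\rceil$. Then $\textsc{Fast}(\mathcal G,b,S,\psi)$ halts with probability $1$, and its expected running time is at most $$C\cdot b\,\bigl(n\psi+m\lceil d_{\max}\rceil\bigr),$$ where the constant $C$ depends only on $\alpha$. In each of its $b$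 rounds it selects, among the edge rewirings $(i,j,k)$ of the current graph with $k\in K$, one that maximizes $\widehat\Delta'((i,j,k),S)$, unless there is no such rewiring. Hence $R$ consists of exactly $b$ edge rewirings whenever every round has at least one such rewiring; this is always the case if some node has at least one and fewer than $\min(n,\lceil d_{\max}\rceil)-1$ out-neighbours. -/

import Mathlib

open scoped ENNReal NNReal

namespace FastPR

noncomputable section

/-! ## Randomised computations with a step count -/

/-- The law of a randomised computation with result type `α`: `p.law (a, t)` is the probability
that it halts with result `a` after exactly `t` elementary steps. Mass that is missing from the
total is the probability of running forever. The cost model is the unit-cost real RAM: an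
arithmetic operation, a comparison, an array access, a call of `Rand()` and a call of
`RandomNeighbor` (sampling tables are built together with the graph) take `O(1)` steps. -/
structure RandTime (α : Type) where
  law : α × ℕ → ℝ≥0∞

namespace RandTime

open Classical in
/-- Return `a` in zero steps. -/
def ret {α : Type} (a : α) : RandTime α := ⟨fun x => if x = (a, 0) then 1 else 0⟩

/-- Run `p`, then `f` on its result; the numbers of steps add up. -/
def andThen {α β : Type} (p : RandTime α) (f : α → RandTime β) : RandTime β :=
  ⟨fun y => ∑' x : α × ℕ, p.law x * (if x.2 ≤ y.2 then (f x.1).law (y.1, y.2 - x.2) else 0)⟩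

instance : Monad RandTime where
  pure := ret
  bind := andThen

/-- Spend `c` steps. -/
def tick (c : ℕ) : RandTime Unit := ⟨fun x => if x.2 = c then 1 else 0⟩

/-- The test `Rand() ≤ q`, for `Rand()` uniform in `[0, 1]` and `q ≤ 1`; one step. -/
def randLE (q : ℝ≥0) : RandTime Bool :=
  ⟨fun x => if x.2 = 1 then (if x.1 then (q : ℝ≥0∞) else ((1 - q : ℝ≥0) : ℝ≥0∞)) else 0⟩

/-- `while cond s do s ← body s`, restricted to the runs that evaluate the condition at most `k`
times (all other runs yield no result). Evaluating the condition takes one step. -/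
def loopUpTo {σ : Type} (cond : σ → Bool) (body : σ → RandTime σ) : ℕ → σ → RandTime σ
  | 0, _ => ⟨fun _ => 0⟩
  | k + 1, s => do
    tick 1
    if cond s then
      let s' ← body s
      loopUpTo cond body k s'
    else
      pure s

/-- `while cond s do s ← body s`; the least fixed point of unfolding the loop. -/
def whileLoop {σ : Type} (cond : σ → Bool) (body : σ → RandTime σ) (s : σ) : RandTime σ :=
  ⟨fun x => ⨆ k, (loopUpTo cond body k s).law x⟩

/-- The probability of halting. -/
def haltProb {α : Type} (p : RandTime α) : ℝ≥0∞ := ∑' x, p.law x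

/-- The expected number of steps; it is infinite if the computation runs forever with positive
probability. -/
def expectedTime {α : Type} (p : RandTime α) : ℝ≥0∞ :=
  (∑' x, p.law x * (x.2 : ℝ≥0∞)) + (1 - haltProb p) * ⊤

end RandTime

open RandTime

/-! ## Weighted digraphs and rewirings -/

/-- A weighted digraph on the nodes `0, …, n - 1`, given by its adjacency matrix: `(i, j)` is an
edge iff `w i j ≠ 0`, and then `w i j > 0` is its weight. -/
structure WDigraph (n : ℕ) where
  w : Fin n → Fin n → ℝ≥0

namespace WDigraph

variable {n : ℕ}

/-- `(i, j) ∈ E`. -/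
def Edge (G : WDigraph n) (i j : Fin n) : Prop := G.w i j ≠ 0

/-- The adjacency list of `i` (its out-neighbours). -/
def nbrs (G : WDigraph n) (i : Fin n) : List (Fin n) :=
  (List.finRange n).filter fun j => G.w i j ≠ 0

/-- The number `m` of edges. -/
def numEdges (G : WDigraph n) : ℕ :=
  (Finset.univ.filter fun e : Fin n × Fin n => G.w e.1 e.2 ≠ 0).card

/-- The out-degree `d_i = ∑ j, A_ij`. -/
def deg (G : WDigraph n) (i : Fin n) : ℝ≥0 := ∑ j, G.w i j

/-- The maximum out-degree. -/
def dmax (G : WDigraph n) : ℝ≥0 := Finset.univ.sup G.deg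

/-- The transition probability `p_ij`. -/
def p (G : WDigraph n) (i j : Fin n) : ℝ≥0 := G.w i j / G.deg i

/-- Replace the weight of `(i, j)` by `a`. -/
def setWeight (G : WDigraph n) (i j : Fin n) (a : ℝ≥0) : WDigraph n where
  w := fun x y => if x = i ∧ y = j then a else G.w x y

/-- Replace the edge `(i, j)` by `(i, k)`, which inherits its weight. -/
def rewire (G : WDigraph n) (c : Fin n × Fin n × Fin n) : WDigraph n :=
  (G.setWeight c.1 c.2.2 (G.w c.1 c.2.1)).setWeight c.1 c.2.1 0

/-- Perform a rewiring, if there is one. -/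
def rewireOpt (G : WDigraph n) : Option (Fin n × Fin n × Fin n) → WDigraph n
  | none => G
  | some c => G.rewire c

/-- `(i, j, k)` is an edge rewiring: `(i, j) ∈ E`, `(i, k) ∉ E` and `i ≠ k`. -/
def IsRewiring (G : WDigraph n) (c : Fin n × Fin n × Fin n) : Prop :=
  G.Edge c.1 c.2.1 ∧ ¬ G.Edge c.1 c.2.2 ∧ c.1 ≠ c.2.2

/-- The edge rewirings of `G` whose new end point lies in `K`. -/
def candidates (G : WDigraph n) (K : Finset (Fin n)) : Set (Fin n × Fin n × Fin n) :=
  {c | G.IsRewiring c ∧ c.2.2 ∈ K}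

end WDigraph

variable {n : ℕ}

/-- The estimated gain `(1 - α) p_ij σ'_i (η'_k - η'_j)` of the rewiring `(i, j, k)`. -/
def gain (α : ℝ≥0) (G : WDigraph n) (σ η : Fin n → ℝ) (c : Fin n × Fin n × Fin n) : ℝ :=
  (1 - (α : ℝ)) * (G.p c.1 c.2.1 : ℝ) * σ c.1 * (η c.2.2 - η c.2.1)

/-! ## Sampling a rooted spanning forest -/

/-- `RandomNeighbor(G, u)`: the out-neighbour `v` of `u` with probability `w(u, v) / d_u`;
one step. -/
def randomNeighbor (G : WDigraph n) (u : Fin n) : RandTime (Fin n) :=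
  ⟨fun x => if x.2 = 1 then ((G.w u x.1 / G.deg u : ℝ≥0) : ℝ≥0∞) else 0⟩

/-- The arrays `InForest`, `Next` (`none` stands for `-1`) and `Root` (initialised by the
dummy value `Root[u] = u`). -/
structure Arrays (n : ℕ) where
  inForest : Fin n → Bool
  next : Fin n → Option (Fin n)
  root : Fin n → Fin n

/-- The body of the first inner loop: become a root, or walk to a random out-neighbour. The second
component of the state is the current node. -/
def walkStep (G : WDigraph n) (s : Arrays n × Fin n) : RandTime (Arrays n × Fin n) := do
  let u := s.2
  let atRoot ← randLE (1 / (1 + G.deg u))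
  if atRoot then
    tick 3
    pure ({ inForest := Function.update s.1.inForest u true
            next := Function.update s.1.next u none
            root := Function.update s.1.root u u }, u)
  else
    let v ← randomNeighbor G u
    tick 2
    pure ({ s.1 with next := Function.update s.1.next u (some v) }, v)

/-- The body of the second inner loop: put the current node into the forest with root `r`, and move
on along `Next`. -/
def retraceStep (r : Fin n) (s : Arrays n × Fin n) : RandTime (Arrays n × Fin n) := do
  let u := s.2
  tick 3
  pure ({ s.1 with
          inForest := Function.update s.1.inForest u true
          root := Function.update s.1.root u r }, (s.1.next u).getD u)

/-- One pass of the outer loop: the loop-erased walk from `i` becomes a branch of the forest. -/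
def branch (G : WDigraph n) (A : Arrays n) (i : Fin n) : RandTime (Arrays n) := do
  tick 1
  let s ← whileLoop (fun s => !s.1.inForest s.2) (walkStep G) (A, i)
  tick 2
  let r := s.1.root s.2
  let s' ← whileLoop (fun s => !s.1.inForest s.2) (retraceStep r) (s.1, i)
  pure s'.1

/-- `RandomForest(G)`; the result is the array `Root`. -/
def randomForest (G : WDigraph n) : RandTime (Fin n → Fin n) := do
  tick (3 * n)
  let A ← (List.finRange n).foldlM (branch G)
    { inForest := fun _ => false, next := fun _ => none, root := fun u => u }
  pure A.root

/-! ## The algorithm `Fast` -/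

/-- Build the reweighted graph, `w_r(i, j) = w(i, j) / (α / (1 - α) * d_i)`, together with its
out-degrees and the tables for `RandomNeighbor`. -/
def buildReweighted (α : ℝ≥0) (G : WDigraph n) : RandTime (WDigraph n) :=
  (List.finRange n).foldlM (fun Gr i => do
    tick 1
    (G.nbrs i).foldlM (fun (Gr : WDigraph n) j => do
      tick 3
      pure (Gr.setWeight i j (G.w i j / (α / (1 - α) * G.deg i)))) Gr)
    { w := fun _ _ => 0 }

/-- The counters for `σ'` and `η'`, and a record of the arrays `Root` sampled so far. -/
structure Tally (n : ℕ) where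
  cσ : Fin n → ℕ
  cη : Fin n → ℕ
  roots : List (Fin n → Fin n)

/-- Count node `j` of the sampled forest. -/
def countNode (S : Finset (Fin n)) (root : Fin n → Fin n) (T : Tally n) (j : Fin n) :
    RandTime (Tally n) := do
  tick 4
  let u := root j
  pure { T with
         cσ := Function.update T.cσ u (T.cσ u + 1)
         cη := if u ∈ S then Function.update T.cη j (T.cη j + 1) else T.cη }

/-- Sample one forest and count all its nodes. -/
def sampleOnce (S : Finset (Fin n)) (Gr : WDigraph n) (T : Tally n) : RandTime (Tally n) := do
  tick 1
  let root ← randomForest Gr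
  let T' ← (List.finRange n).foldlM (countNode S root) T
  pure { T' with roots := T'.roots ++ [root] }

/-- Sample `ψ` forests. -/
def sample (S : Finset (Fin n)) (Gr : WDigraph n) (ψ : ℕ) : RandTime (Tally n) := do
  tick (2 * n)
  (List.range ψ).foldlM (fun T _ => sampleOnce S Gr T)
    { cσ := fun _ => 0, cη := fun _ => 0, roots := [] }

/-- The maximum of the (stored) out-degrees. -/
def findDmax (G : WDigraph n) : RandTime ℝ≥0 :=
  (List.finRange n).foldlM (fun d i => do
    tick 2
    pure (max d (G.deg i))) 0

/-- Collect nodes of highest count as long as there are fewer than `d` of them, by a bucket sort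
(the counts are at most `ψ`). -/
def topNodes (ψ : ℕ) (c : Fin n → ℕ) (d : ℝ≥0) : RandTime (List (Fin n)) := do
  tick (ψ + 1)
  let B ← (List.finRange n).foldlM (fun (B : ℕ → List (Fin n)) j => do
    tick 2
    pure (Function.update B (c j) (j :: B (c j)))) (fun _ => [])
  (List.range (ψ + 1)).reverse.foldlM (fun K v => do
    tick 1
    (B v).foldlM (fun (K : List (Fin n)) u => do
      tick 3
      pure (if (K.length : ℝ≥0) < d then u :: K else K)) K) []

open Classical in
/-- Compare the rewirings `(i, j, k)`, `k ∈ K`, with the best one found so far; `mark` is the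
indicator array of the out-neighbours of `i`. -/
def scanEdge (f : Fin n × Fin n × Fin n → ℝ) (K : List (Fin n)) (mark : Fin n → Bool) (i : Fin n)
    (best : Option (Fin n × Fin n × Fin n)) (j : Fin n) :
    RandTime (Option (Fin n × Fin n × Fin n)) :=
  K.foldlM (fun best k => do
    tick 10
    pure (if k ≠ i ∧ mark k = false ∧ ∀ c ∈ best, f c < f (i, j, k) then some (i, j, k) else best))
    best

/-- Set all entries of `mark` at the out-neighbours of `i` to `v`. -/
def setMarks (G : WDigraph n) (i : Fin n) (v : Bool) (mark : Fin n → Bool) :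
    RandTime (Fin n → Bool) :=
  (G.nbrs i).foldlM (fun mark j => do
    tick 1
    pure (Function.update mark j v)) mark

/-- A rewiring with new end point in `K` that maximises `f`, by going through all edges and all
members of `K`; `none` if there is no such rewiring. -/
def findBest (G : WDigraph n) (f : Fin n × Fin n × Fin n → ℝ) (K : List (Fin n)) :
    RandTime (Option (Fin n × Fin n × Fin n)) := do
  tick n
  let s ← (List.finRange n).foldlM
    (fun (s : (Fin n → Bool) × Option (Fin n × Fin n × Fin n)) i => do
      tick 1
      let mark ← setMarks G i true s.1
      let best ← (G.nbrs i).foldlM (fun best j => do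
        tick 1
        scanEdge f K mark i best j) s.2
      let mark' ← setMarks G i false mark
      pure (mark', best)) (fun _ => false, none)
  pure s.2

/-- The record of one round: the sampled arrays `Root`, the target set `K`, and the selected
rewiring (`none` if there was nothing to select from). -/
structure Round (n : ℕ) where
  roots : List (Fin n → Fin n)
  targets : Finset (Fin n)
  choice : Option (Fin n × Fin n × Fin n)

/-- The variables of `Fast`: the current graph and the solution `R`, and a record `trace` of the
rounds (which the algorithm itself never reads). -/
structure FastState (n : ℕ) where
  graph : WDigraph n
  R : List (Fin n × Fin n × Fin n)
  trace : List (Round n)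

/-- One round of `Fast`. The update rewrites the adjacency list of one node. -/
def fastRound (α : ℝ≥0) (S : Finset (Fin n)) (ψ : ℕ) (s : FastState n) :
    RandTime (FastState n) := do
  let G := s.graph
  let Gr ← buildReweighted α G
  let T ← sample S Gr ψ
  tick (2 * n)
  let σ : Fin n → ℝ := fun v => T.cσ v / (n * ψ)
  let η : Fin n → ℝ := fun v => T.cη v / ψ
  let d ← findDmax G
  let K ← topNodes ψ T.cη d
  let best ← findBest G (gain α G σ η) K
  match best with
  | none =>
    pure { s with trace := s.trace ++ [⟨T.roots, K.toFinset, none⟩] }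
  | some c =>
    tick (1 + 2 * (G.nbrs c.1).length)
    pure { graph := G.rewire c
           R := s.R ++ [c]
           trace := s.trace ++ [⟨T.roots, K.toFinset, some c⟩] }

/-- `Fast(G, b, S, ψ)` with restart probability `α`. -/
def fast (α : ℝ≥0) (G : WDigraph n) (b : ℕ) (S : Finset (Fin n)) (ψ : ℕ) :
    RandTime (FastState n) := do
  tick 1
  (List.range b).foldlM (fun s _ => do
    tick 1
    fastRound α S ψ s) { graph := G, R := [], trace := [] }

/-! ## What the rounds have to satisfy -/

/-- `σ'_s`: the mean, over the sampled forests, of the fraction of nodes that have root `s`. -/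
def sigmaEst (ψ : ℕ) (roots : List (Fin n → Fin n)) (s : Fin n) : ℝ :=
  (roots.map fun r => ((Finset.univ.filter fun u => r u = s).card : ℝ)).sum / (n * ψ)

/-- `η'_s`: the fraction of the sampled forests in which the root of `s` is in `S`. -/
def etaEst (S : Finset (Fin n)) (ψ : ℕ) (roots : List (Fin n → Fin n)) (s : Fin n) : ℝ :=
  (roots.map fun r => if r s ∈ S then (1 : ℝ) else 0).sum / ψ

/-- `K` consists of the top `⌈d⌉` nodes of `η` (of all nodes, if there are fewer). -/
def IsTopSet (d : ℝ≥0) (η : Fin n → ℝ) (K : Finset (Fin n)) : Prop :=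
  K.card = min n ⌈d⌉₊ ∧ ∀ u ∈ K, ∀ v, v ∉ K → η v ≤ η u

/-- In a round on the graph `G`, `ψ` forests were sampled, `K` is a top set for `η'`, and the
selected rewiring maximises the estimated gain; none is selected only if there is none. -/
def IsGreedyRound (α : ℝ≥0) (S : Finset (Fin n)) (ψ : ℕ) (G : WDigraph n) (r : Round n) : Prop :=
  r.roots.length = ψ ∧
  IsTopSet G.dmax (etaEst S ψ r.roots) r.targets ∧
  match r.choice with
  | none => G.candidates r.targets = ∅
  | some c => c ∈ G.candidates r.targets ∧ ∀ c' ∈ G.candidates r.targets,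
      gain α G (sigmaEst ψ r.roots) (etaEst S ψ r.roots) c' ≤
        gain α G (sigmaEst ψ r.roots) (etaEst S ψ r.roots) c

/-- All rounds are greedy, each on the graph that the earlier rounds have left. -/
def IsGreedyRun (α : ℝ≥0) (S : Finset (Fin n)) (ψ : ℕ) : WDigraph n → List (Round n) → Prop
  | _, [] => True
  | G, r :: rs => IsGreedyRound α S ψ G r ∧ IsGreedyRun α S ψ (G.rewireOpt r.choice) rs

/-- In every round there is a rewiring with new end point in the target set of the round. -/
def AlwaysCandidates : WDigraph n → List (Round n) → Prop
  | _, [] => True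
  | G, r :: rs => (G.candidates r.targets).Nonempty ∧ AlwaysCandidates (G.rewireOpt r.choice) rs

end

end FastPR

open FastPR

/-! Halting, expected time and correctness are proved together. A `Triple` says that a computation
halts almost surely, that its expected time plus the potential of its result is within a budget, and
that every possible result satisfies a postcondition. Budgets compose along `bind` (`Triple.bind`).
A loop whose finite potential pays for each test of the condition and each pass of the body halts
almost surely (`Triple.whileLoop`): k unfinished tests cost at least k, so the probability of being
unfinished after k tests is at most potential/k.

The point of the reweighting is that every nonzero out-degree becomes (1-α)/α, so a walk stops at
each node with probability at least α (`le_rootProb_reweighted`). The potential of a walk has a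
constant a ≥ 9/α for the part still to come, and 4 for each pointer hop from the start to the
current node. A step adds at most one hop, however many loops it erases, so the second part prepays
the retracing (`Triple_walk`, `Triple_retrace`). Hence a branch costs O(1/α) and a forest O(n/α),
with no dependence on the graph.

The remaining work in a round is linear in n, ψ and m, except for the scan of all pairs of an edge
and a member of K, which is O(m⌈d_max⌉). Invariants of the list loops show that the bucket sort
yields a top set (`isTopSet_sortedNodes`) and the scan a maximiser (`Spec_findBest`). A rewiring
permutes a row of the adjacency matrix (`WDigraph.rewire_w`), so degrees, m and d_max never change,
and one bound serves all rounds. For the same reason a node with few out-neighbours keeps this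
property, and K always has a member outside it and its neighbourhood
(`WDigraph.candidates_nonempty`). -/

namespace FastPR
namespace RandTime

/-! ## A quantitative Hoare logic -/

variable {α β : Type}

/-- The expectation of `F` over the halting runs. -/
noncomputable def expect (p : RandTime α) (F : α × ℕ → ℝ≥0∞) : ℝ≥0∞ := ∑' x, p.law x * F x

theorem expect_mono {p : RandTime α} {F F' : α × ℕ → ℝ≥0∞}
    (h : ∀ x, p.law x ≠ 0 → F x ≤ F' x) : p.expect F ≤ p.expect F' := by
  refine ENNReal.tsum_le_tsum fun x => ?_
  by_cases hx : p.law x = 0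
  · simp [hx]
  · gcongr
    exact h x hx

theorem expect_congr {p : RandTime α} {F F' : α × ℕ → ℝ≥0∞}
    (h : ∀ x, p.law x ≠ 0 → F x = F' x) : p.expect F = p.expect F' :=
  le_antisymm (expect_mono fun x hx => (h x hx).le) (expect_mono fun x hx => (h x hx).ge)

theorem expect_add (p : RandTime α) (F F' : α × ℕ → ℝ≥0∞) :
    p.expect (fun x => F x + F' x) = p.expect F + p.expect F' := by
  simp [expect, mul_add, ENNReal.tsum_add]

theorem expect_const_mul (p : RandTime α) (c : ℝ≥0∞) (F : α × ℕ → ℝ≥0∞) :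
    p.expect (fun x => c * F x) = c * p.expect F := by
  simp only [expect, ← ENNReal.tsum_mul_left]
  exact tsum_congr fun x => by ring

theorem expect_const (p : RandTime α) (c : ℝ≥0∞) :
    p.expect (fun _ => c) = c * p.haltProb := by
  rw [expect, ENNReal.tsum_mul_right, mul_comm, haltProb]

theorem haltProb_eq_expect (p : RandTime α) : p.haltProb = p.expect fun _ => 1 := by
  simp [expect_const]

/-- Shifting times by `x.2` is injective with range the times `≥ x.2`, exactly where the law of the
composite is supported; the rest is Tonelli. -/
theorem expect_bind (p : RandTime α) (f : α → RandTime β) (F : β × ℕ → ℝ≥0∞) :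
    (p >>= f).expect F = p.expect fun x => (f x.1).expect fun z => F (z.1, x.2 + z.2) := by
  have key : ∀ x : α × ℕ, ∑' y : β × ℕ,
      (if x.2 ≤ y.2 then (f x.1).law (y.1, y.2 - x.2) else 0) * F y
        = ∑' z, (f x.1).law z * F (z.1, x.2 + z.2) := by
    intro x
    have hinj : Function.Injective fun z : β × ℕ => (z.1, x.2 + z.2) := by
      rintro ⟨a, s⟩ ⟨b, t⟩ h
      simpa using h
    rw [← hinj.tsum_eq]
    · exact tsum_congr fun z => by simp
    · rintro ⟨b, t⟩ h
      by_cases hx : x.2 ≤ t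
      · exact ⟨(b, t - x.2), by simp [hx]⟩
      · simp [hx] at h
  change ∑' y, (∑' x : α × ℕ, p.law x * _) * F y = ∑' x, p.law x * ∑' z, _
  simp_rw [← key, ← ENNReal.tsum_mul_left, ← ENNReal.tsum_mul_right]
  rw [ENNReal.tsum_comm]
  simp_rw [mul_assoc]

theorem expect_pure (a : α) (F : α × ℕ → ℝ≥0∞) :
    (pure a : RandTime α).expect F = F (a, 0) := by
  change ∑' x, (ret a).law x * F x = _
  rw [tsum_eq_single (a, 0)] <;> simp +contextual [RandTime.ret]

theorem expect_tick (c : ℕ) (F : Unit × ℕ → ℝ≥0∞) : (tick c).expect F = F ((), c) := by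
  change ∑' x : Unit × ℕ, (if x.2 = c then (1 : ℝ≥0∞) else 0) * F x = _
  rw [tsum_eq_single ((), c)]
  · simp
  · rintro ⟨_, t⟩ h
    have : t ≠ c := by rintro rfl; exact h rfl
    simp [this]

theorem support_bind {p : RandTime α} {f : α → RandTime β} {y : β × ℕ}
    (h : (p >>= f).law y ≠ 0) : ∃ x z, p.law x ≠ 0 ∧ (f x.1).law z ≠ 0 ∧ z.1 = y.1 := by
  change ∑' x : α × ℕ, p.law x * _ ≠ 0 at h
  rw [Ne, ENNReal.tsum_eq_zero, not_forall] at h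
  obtain ⟨x, hx⟩ := h
  rw [mul_eq_zero, not_or] at hx
  obtain ⟨h1, h2⟩ := hx
  split_ifs at h2 with h3
  · exact ⟨x, _, h1, h2, rfl⟩
  · exact absurd rfl h2

theorem support_pure {a : α} {y : α × ℕ} (h : (pure a : RandTime α).law y ≠ 0) : y = (a, 0) := by
  by_contra hy
  exact h (if_neg hy)

/-- `p` halts almost surely, the expected value of its time plus the potential `Φ` of its result
is at most `c`, and all its results satisfy `Q`. -/
structure Triple (p : RandTime α) (c : ℝ≥0∞) (Q : α → Prop) (Φ : α → ℝ≥0∞) : Prop where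
  halts : p.haltProb = 1
  cost : p.expect (fun x => x.2 + Φ x.1) ≤ c
  post : ∀ x, p.law x ≠ 0 → Q x.1

theorem Triple.weaken {p : RandTime α} {c c' : ℝ≥0∞} {Q Q' : α → Prop} {Φ Φ' : α → ℝ≥0∞}
    (h : Triple p c Q Φ) (hc : c ≤ c') (hQ : ∀ a, Q a → Q' a) (hΦ : ∀ a, Q a → Φ' a ≤ Φ a) :
    Triple p c' Q' Φ' where
  halts := h.halts
  cost := (expect_mono fun x hx => by gcongr; exact hΦ _ (h.post x hx)).trans (h.cost.trans hc)
  post x hx := hQ _ (h.post x hx)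

/-- A frame rule: since `p` halts with probability one, a constant carried along contributes exactly
itself. -/
theorem Triple.add {p : RandTime α} {c : ℝ≥0∞} {Q : α → Prop} {Φ : α → ℝ≥0∞}
    (h : Triple p c Q Φ) (d : ℝ≥0∞) : Triple p (c + d) Q (fun a => Φ a + d) where
  halts := h.halts
  cost := by
    simp_rw [← add_assoc]
    rw [expect_add, expect_const, h.halts, mul_one]
    gcongr
    exact h.cost
  post := h.post

/-- Total expectation: the potential left by `p` is the budget of `f`. -/
theorem Triple.bind {p : RandTime α} {f : α → RandTime β} {c : ℝ≥0∞} {Q : α → Prop}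
    {Q' : β → Prop} {Φ : α → ℝ≥0∞} {Φ' : β → ℝ≥0∞} (hp : Triple p c Q Φ)
    (hf : ∀ a, Q a → Triple (f a) (Φ a) Q' Φ') : Triple (p >>= f) c Q' Φ' where
  halts := by
    rw [haltProb_eq_expect, expect_bind]
    refine (expect_congr (F' := fun _ => 1) fun x hx => ?_).trans
      (by rw [← haltProb_eq_expect, hp.halts])
    rw [← haltProb_eq_expect, (hf _ (hp.post x hx)).halts]
  cost := by
    rw [expect_bind]
    refine le_trans (expect_mono fun x hx => ?_) hp.cost
    have h := hf _ (hp.post x hx)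
    simp_rw [Nat.cast_add, add_assoc]
    rw [expect_add, expect_const, h.halts, mul_one]
    gcongr
    exact h.cost
  post y hy := by
    obtain ⟨x, z, hx, hz, h⟩ := support_bind hy
    rw [← h]
    exact (hf _ (hp.post x hx)).post z hz

theorem Triple.ret {a : α} {Q : α → Prop} {Φ : α → ℝ≥0∞} (h : Q a) :
    Triple (pure a) (Φ a) Q Φ where
  halts := by rw [haltProb_eq_expect, expect_pure]
  cost := by simp [expect_pure]
  post x hx := by rw [support_pure hx]; exact h

theorem Triple.tick (c : ℕ) (Φ : Unit → ℝ≥0∞) :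
    Triple (tick c) (c + Φ ()) (fun _ => True) Φ where
  halts := by rw [haltProb_eq_expect, expect_tick]
  cost := by rw [expect_tick]
  post _ _ := trivial

theorem Triple.tick_bind {c : ℕ} {d : ℝ≥0∞} {f : Unit → RandTime β} {Q : β → Prop}
    {Φ : β → ℝ≥0∞} (h : Triple (f ()) d Q Φ) : Triple (RandTime.tick c >>= f) (c + d) Q Φ :=
  (Triple.tick c fun _ => d).bind fun _ _ => h

/-! ### Loops -/

variable {σ : Type} {cond : σ → Bool} {body : σ → RandTime σ}

theorem loopUpTo_succ (k : ℕ) (s : σ) : loopUpTo cond body (k + 1) s =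
    tick 1 >>= fun _ => if cond s then body s >>= loopUpTo cond body k else pure s := rfl

theorem bind_law_mono {p : RandTime α} {f g : α → RandTime β}
    (h : ∀ a x, (f a).law x ≤ (g a).law x) (x : β × ℕ) : (p >>= f).law x ≤ (p >>= g).law x := by
  change ∑' y : α × ℕ, p.law y * _ ≤ ∑' y : α × ℕ, p.law y * _
  refine ENNReal.tsum_le_tsum fun y => ?_
  gcongr
  split_ifs
  · exact h _ _
  · rfl

theorem loopUpTo_law_mono (x : σ × ℕ) (s : σ) :
    Monotone fun k => (loopUpTo cond body k s).law x := by
  refine monotone_nat_of_le_succ fun k => ?_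
  induction k generalizing s x with
  | zero => exact zero_le
  | succ k ih =>
    rw [loopUpTo_succ, loopUpTo_succ]
    refine bind_law_mono (fun _ y => ?_) x
    split_ifs
    · exact bind_law_mono (fun a z => ih z a) y
    · rfl

/-- Monotone convergence, as the truncated laws increase with the number of allowed tests. -/
theorem expect_whileLoop (s : σ) (F : σ × ℕ → ℝ≥0∞) :
    (whileLoop cond body s).expect F = ⨆ k, (loopUpTo cond body k s).expect F := by
  simp only [expect]
  have h : ∀ x, (whileLoop cond body s).law x * F x
      = ⨆ k, (loopUpTo cond body k s).law x * F x := fun x => by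
    rw [← ENNReal.iSup_mul]; rfl
  simp_rw [h, ENNReal.tsum_eq_iSup_sum]
  rw [iSup_comm]
  refine iSup_congr fun t => ?_
  rw [ENNReal.finsetSum_iSup_of_monotone]
  intro x k l hkl
  exact mul_le_mul_left (loopUpTo_law_mono x s hkl) _

/-- A loop whose potential `Ψ` pays for the evaluation of its condition and for its body. -/
theorem Triple.whileLoop {I : σ → Prop} {Ψ Φ : σ → ℝ≥0∞} {c : σ → ℝ≥0∞}
    (hfalse : ∀ s, I s → cond s = false → 1 + Φ s ≤ Ψ s)
    (htrue : ∀ s, I s → cond s = true → Triple (body s) (c s) I Ψ ∧ 1 + c s ≤ Ψ s)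
    {s : σ} (hs : I s) (hfin : Ψ s ≠ ⊤) :
    Triple (whileLoop cond body s) (Ψ s) (fun s' => I s' ∧ cond s' = false) Φ := by
  -- Truncated loops are sub-probabilities, so time already spent is counted at most once in
  -- `cost_le`.
  have mass_le : ∀ k s, I s → (loopUpTo cond body k s).haltProb ≤ 1 := by
    intro k
    induction k with
    | zero => intro s _; simp [loopUpTo, haltProb]
    | succ k ih =>
      intro s hs
      rw [loopUpTo_succ, haltProb_eq_expect, expect_bind, expect_tick]
      cases hc : cond s with
      | false => simp [expect_pure]
      | true =>
        obtain ⟨h, -⟩ := htrue s hs hc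
        rw [if_pos rfl, expect_bind]
        refine le_trans (expect_mono (F' := fun _ => 1) fun x hx => ?_)
          (by rw [← haltProb_eq_expect, h.halts])
        rw [← haltProb_eq_expect]
        exact ih _ (h.post x hx)
  have cost_le : ∀ k s, I s →
      (loopUpTo cond body k s).expect (fun x => x.2 + Φ x.1) ≤ Ψ s := by
    intro k
    induction k with
    | zero => intro s _; simp [loopUpTo, expect]
    | succ k ih =>
      intro s hs
      rw [loopUpTo_succ, expect_bind, expect_tick]
      cases hc : cond s with
      | false => simpa [expect_pure] using hfalse s hs hc
      | true =>
        obtain ⟨h, h'⟩ := htrue s hs hc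
        rw [if_pos rfl, expect_bind]
        refine le_trans ?_ h'
        refine le_trans (b := (body s).expect fun x => 1 + (x.2 + Ψ x.1)) ?_ ?_
        · refine expect_mono fun x hx => ?_
          simp_rw [Nat.cast_add, Nat.cast_one, add_assoc]
          rw [expect_add, expect_add, expect_const, expect_const]
          have hm := mass_le k _ (h.post x hx)
          gcongr
          · simpa using hm
          · exact mul_le_of_le_one_right' hm
          · exact ih _ (h.post x hx)
        · rw [expect_add, expect_const, h.halts, mul_one]
          gcongr
          exact h.cost
  have support : ∀ k s, I s → ∀ x, (loopUpTo cond body k s).law x ≠ 0 →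
      I x.1 ∧ cond x.1 = false := by
    intro k
    induction k with
    | zero => intro s _ x hx; exact absurd rfl hx
    | succ k ih =>
      intro s hs y hy
      rw [loopUpTo_succ] at hy
      obtain ⟨_, y', -, hy', h1⟩ := support_bind hy
      rw [← h1]
      cases hc : cond s with
      | false =>
        rw [hc] at hy'
        rw [support_pure hy']
        exact ⟨hs, hc⟩
      | true =>
        rw [hc] at hy'
        obtain ⟨x, z, hx, hz, h2⟩ := support_bind hy'
        rw [← h2]
        exact ih _ ((htrue s hs hc).1.post x hx) z hz
  -- A Markov inequality without subtraction: a run cut off at `k` has made `k` tests, each paid for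
  -- by `Ψ`.
  have mass_ge : ∀ (k : ℕ) s, I s → (k : ℝ≥0∞) ≤ k * (loopUpTo cond body k s).haltProb + Ψ s := by
    intro k
    induction k with
    | zero => intro s _; simp
    | succ k ih =>
      intro s hs
      rw [loopUpTo_succ, haltProb_eq_expect, expect_bind, expect_tick]
      cases hc : cond s with
      | false => simp [expect_pure]
      | true =>
        obtain ⟨h, h'⟩ := htrue s hs hc
        rw [if_pos rfl, expect_bind]
        calc ((k + 1 : ℕ) : ℝ≥0∞) = (body s).expect (fun _ => (k : ℝ≥0∞)) + 1 := by
              rw [expect_const, h.halts]; simp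
          _ ≤ (body s).expect (fun x =>
                k * (loopUpTo cond body k x.1).haltProb + Ψ x.1) + 1 := by
              gcongr
              exact expect_mono fun x hx => ih _ (h.post x hx)
          _ ≤ (k + 1 : ℕ) * (body s).expect (fun x => (loopUpTo cond body k x.1).haltProb)
                + (1 + c s) := by
              rw [expect_add, expect_const_mul, add_assoc, add_comm _ (1 : ℝ≥0∞)]
              gcongr
              · simp
              · refine le_trans (expect_mono fun x _ => ?_) h.cost
                exact le_add_self
          _ ≤ _ := by
              simp_rw [haltProb_eq_expect]
              gcongr
  refine ⟨?_, ?_, ?_⟩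
  · rw [haltProb_eq_expect, expect_whileLoop]
    simp_rw [← haltProb_eq_expect]
    refine le_antisymm (iSup_le fun k => mass_le k s hs) ?_
    refine le_of_forall_lt fun r hr => ?_
    rw [lt_iSup_iff]
    -- If all halting masses were at most `r < 1`, then `k * (1 - r) ≤ Ψ s` for every `k`, against
    -- the finiteness of `Ψ s`.
    by_contra! hcon
    have hd0 : (1 - r) ≠ 0 := (tsub_pos_of_lt hr).ne'
    obtain ⟨k, hk⟩ := ENNReal.exists_nat_gt (ENNReal.div_lt_top hfin hd0).ne
    have h1 := mass_ge k s hs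
    have h2 : (k : ℝ≥0∞) ≤ k * r + Ψ s := h1.trans (by gcongr; exact hcon k)
    have h3 : (k : ℝ≥0∞) * (1 - r) ≤ Ψ s := by
      rw [ENNReal.mul_sub (by simp), mul_one]
      exact tsub_le_iff_left.mpr h2
    rw [ENNReal.div_lt_iff (Or.inl hd0) (Or.inr hfin)] at hk
    exact absurd h3 (not_le.mpr hk)
  · rw [expect_whileLoop]
    exact iSup_le fun k => cost_le k s hs
  · intro x hx
    change (⨆ k, _) ≠ (0 : ℝ≥0∞) at hx
    rw [Ne, ENNReal.iSup_eq_zero, not_forall] at hx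
    obtain ⟨k, hk⟩ := hx
    exact support k s hs x hk

/-! ### Computations with a constant bound on the expected time -/

/-- `p` halts almost surely, takes at most `c` steps on average, and all its results
satisfy `Q`. -/
def Spec (p : RandTime α) (c : ℕ) (Q : α → Prop) : Prop := Triple p c Q fun _ => 0

theorem Spec.weaken {p : RandTime α} {c c' : ℕ} {Q Q' : α → Prop} (h : Spec p c Q)
    (hc : c ≤ c') (hQ : ∀ a, Q a → Q' a) : Spec p c' Q' :=
  Triple.weaken h (by exact_mod_cast hc) hQ fun _ _ => le_rfl

theorem Spec.bind {p : RandTime α} {f : α → RandTime β} {c d : ℕ} {Q : α → Prop}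
    {Q' : β → Prop} (hp : Spec p c Q) (hf : ∀ a, Q a → Spec (f a) d Q') :
    Spec (p >>= f) (c + d) Q' := by
  have := (Triple.add hp d).bind (f := f) (Q' := Q') (Φ' := fun _ => 0)
    fun a ha => by simpa [Spec] using hf a ha
  simpa [Spec] using this

theorem Spec.ret {a : α} {Q : α → Prop} (h : Q a) : Spec (pure a) 0 Q := by
  simpa [Spec] using Triple.ret (Φ := fun _ => 0) h

theorem Spec.tick_bind {c d : ℕ} {f : Unit → RandTime β} {Q : β → Prop}
    (h : Spec (f ()) d Q) : Spec (RandTime.tick c >>= f) (c + d) Q := by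
  simpa [Spec] using Triple.tick_bind (c := c) h

theorem Spec.tick_ret {c : ℕ} {a : α} {Q : α → Prop} (h : Q a) :
    Spec (RandTime.tick c >>= fun _ => pure a) c Q :=
  Spec.tick_bind (f := fun _ => pure a) (Spec.ret h)

/-- The invariant `I l s` of a loop over a list speaks about the list `l` of members already
processed. -/
theorem Spec.foldlM {ι : Type} {f : σ → ι → RandTime σ} {c : ι → ℕ} (I : List ι → σ → Prop)
    {l : List ι} {s : σ} (h0 : I [] s)
    (hf : ∀ l₁ a l₂ s, l = l₁ ++ a :: l₂ → I l₁ s → Spec (f s a) (c a) (I (l₁ ++ [a]))) :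
    Spec (l.foldlM f s) (l.map c).sum (I l) := by
  suffices ∀ l₂ l₁ s, l = l₁ ++ l₂ → I l₁ s →
      Spec (l₂.foldlM f s) (l₂.map c).sum (I l) from this l [] s rfl h0
  intro l₂
  induction l₂ with
  | nil =>
    intro l₁ s hl hI
    rw [hl, List.append_nil]
    exact Spec.ret hI
  | cons a l₂ ih =>
    intro l₁ s hl hI
    rw [List.foldlM_cons, List.map_cons, List.sum_cons]
    exact (hf l₁ a l₂ s hl hI).bind fun s' hs' => ih (l₁ ++ [a]) s' (by simp [hl]) hs'

theorem Spec.foldlM_const {ι : Type} {f : σ → ι → RandTime σ} {c : ℕ} (I : List ι → σ → Prop)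
    {l : List ι} {s : σ} (h0 : I [] s)
    (hf : ∀ l₁ a l₂ s, l = l₁ ++ a :: l₂ → I l₁ s → Spec (f s a) c (I (l₁ ++ [a]))) :
    Spec (l.foldlM f s) (l.length * c) (I l) := by
  simpa using Spec.foldlM (c := fun _ => c) I h0 hf

end RandTime
end FastPR

namespace FastPR
open RandTime

variable {n : ℕ}

/-! ## Sampling a forest -/

/-- The postcondition records that the outcome `false` is impossible for `q = 1`; it keeps the walk
from asking for a neighbour at a sink. -/
theorem Triple_randLE {q : ℝ≥0} (hq : q ≤ 1) (Φ : Bool → ℝ≥0∞) :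
    Triple (randLE q) (q * (1 + Φ true) + (1 - q : ℝ≥0) * (1 + Φ false))
      (fun a => a = false → q ≠ 1) Φ := by
  have key : ∀ F : Bool × ℕ → ℝ≥0∞,
      (randLE q).expect F = q * F (true, 1) + (1 - q : ℝ≥0) * F (false, 1) := by
    intro F
    have h : ∀ a : Bool, ∑' t : ℕ, (randLE q).law (a, t) * F (a, t)
        = (if a then (q : ℝ≥0∞) else ((1 - q : ℝ≥0) : ℝ≥0∞)) * F (a, 1) := by
      intro a
      rw [tsum_eq_single 1]
      · rfl
      · intro t ht
        simp [randLE, ht]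
    rw [expect, ENNReal.tsum_prod']
    simp_rw [h]
    rw [tsum_fintype]
    simp
  refine ⟨?_, ?_, ?_⟩
  · rw [haltProb_eq_expect, key]
    simp only [mul_one]
    exact_mod_cast add_tsub_cancel_of_le hq
  · rw [key]
    simp
  · rintro ⟨a, t⟩ hx rfl rfl
    apply hx
    simp [randLE]

theorem WDigraph.sum_p {G : WDigraph n} {u : Fin n} (h : G.deg u ≠ 0) : ∑ v, G.p u v = 1 := by
  simp only [WDigraph.p]
  rw [← Finset.sum_div]
  exact div_self h

/-- At degree zero all quotients `w / deg` are zero and the call would have no mass; otherwise they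
sum to one. -/
theorem Triple_randomNeighbor {G : WDigraph n} {u : Fin n} (h : G.deg u ≠ 0) (c : ℝ≥0∞) :
    Triple (randomNeighbor G u) (1 + c) (fun _ => True) (fun _ => c) := by
  have key : ∀ d : ℝ≥0∞, (randomNeighbor G u).expect (fun x => x.2 + d) = 1 + d := by
    intro d
    have h' : ∀ v : Fin n, ∑' t : ℕ, (randomNeighbor G u).law (v, t) * (t + d)
        = (G.p u v : ℝ≥0) * (1 + d) := by
      intro v
      rw [tsum_eq_single 1]
      · simp [randomNeighbor, WDigraph.p]
      · intro t ht
        simp [randomNeighbor, ht]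
    rw [expect, ENNReal.tsum_prod']
    dsimp only
    simp_rw [h']
    rw [tsum_fintype, ← Finset.sum_mul, ← ENNReal.ofNNReal_finsetSum, WDigraph.sum_p h]
    simp
  refine ⟨?_, (key c).le, fun _ _ => trivial⟩
  have h' : ∀ v : Fin n, ∑' t : ℕ, (randomNeighbor G u).law (v, t) = (G.p u v : ℝ≥0) := by
    intro v
    rw [tsum_eq_single 1]
    · simp [randomNeighbor, WDigraph.p]
    · intro t ht
      simp [randomNeighbor, ht]
  rw [haltProb, ENNReal.tsum_prod']
  simp_rw [h']
  rw [tsum_fintype, ← ENNReal.ofNNReal_finsetSum, WDigraph.sum_p h]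
  simp

/-- One step along the pointers `next`; a node without a pointer is a fixed point. -/
def hop (next : Fin n → Option (Fin n)) (x : Fin n) : Fin n := (next x).getD x

/-- The number of steps along the pointers `next` that lead from `x` to `y`. -/
noncomputable def hopDist (next : Fin n → Option (Fin n)) (x y : Fin n) : ℝ≥0∞ :=
  ⨅ k : {k : ℕ // (hop next)^[k] x = y}, (k.1 : ℝ≥0∞)

theorem hopDist_le {next : Fin n → Option (Fin n)} {x y : Fin n} {k : ℕ}
    (h : (hop next)^[k] x = y) : hopDist next x y ≤ k :=
  iInf_le (fun k : {k : ℕ // (hop next)^[k] x = y} => (k.1 : ℝ≥0∞)) ⟨k, h⟩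

@[simp]
theorem hopDist_self (next : Fin n → Option (Fin n)) (x : Fin n) : hopDist next x x = 0 :=
  le_antisymm (by simpa using hopDist_le (next := next) (x := x) (k := 0) rfl) zero_le

/-- A route between distinct nodes begins with a hop. Without a route the right side is `⊤`, an
infimum over the empty set. -/
theorem hopDist_hop_add_one_le {next : Fin n → Option (Fin n)} {x y : Fin n} (h : x ≠ y) :
    hopDist next (hop next x) y + 1 ≤ hopDist next x y := by
  refine le_iInf ?_
  rintro ⟨k, hk⟩
  cases k with
  | zero => exact absurd hk h
  | succ k =>
    push_cast
    gcongr
    exact hopDist_le hk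

/-- Changing the pointer of `y` does not affect the way to `y`. -/
theorem exists_hop_update {next : Fin n → Option (Fin n)} {y : Fin n} (o : Option (Fin n)) (k : ℕ) :
    ∀ x, (hop next)^[k] x = y → ∃ j ≤ k, (hop (Function.update next y o))^[j] x = y := by
  induction k with
  | zero => exact fun x hx => ⟨0, le_rfl, hx⟩
  | succ k ih =>
    intro x hx
    by_cases hxy : x = y
    · exact ⟨0, Nat.zero_le _, hxy⟩
    · obtain ⟨j, hj, h⟩ := ih _ hx
      refine ⟨j + 1, by omega, ?_⟩
      rw [Function.iterate_succ_apply]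
      convert h using 2
      simp [hop, Function.update_of_ne hxy]

theorem hopDist_update_le (next : Fin n → Option (Fin n)) (x y : Fin n) (o : Option (Fin n)) :
    hopDist (Function.update next y o) x y ≤ hopDist next x y := by
  refine le_iInf ?_
  rintro ⟨k, hk⟩
  obtain ⟨j, hj, h⟩ := exists_hop_update o k x hk
  exact (hopDist_le h).trans (by exact_mod_cast hj)

/-- This is how loop erasure is accounted for: overwriting the pointer of `y` leaves a route to `y`,
and the new pointer extends it by one hop to `z`. -/
theorem hopDist_update_some_le (next : Fin n → Option (Fin n)) (x y z : Fin n) :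
    hopDist (Function.update next y (some z)) x z ≤ hopDist next x y + 1 := by
  rw [hopDist.eq_1 next, ENNReal.iInf_add]
  refine le_iInf ?_
  rintro ⟨k, hk⟩
  obtain ⟨j, hj, h⟩ := exists_hop_update (some z) k x hk
  refine (hopDist_le (k := j + 1) ?_).trans ?_
  · rw [Function.iterate_succ_apply', h]
    simp [hop]
  · exact_mod_cast Nat.add_le_add_right hj 1

/-- The pointers stay fixed and `u` stays in the forest, so the loop ends at `u` at the latest. A
hop costs 4, one test and three ticks; the last test costs 1. -/
theorem Triple_retrace {A : Arrays n} {i u r : Fin n} (hu : A.inForest u = true)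
    (hfin : hopDist A.next i u ≠ ⊤) :
    Triple (whileLoop (fun s => !s.1.inForest s.2) (retraceStep r) (A, i))
      (1 + 4 * hopDist A.next i u) (fun _ => True) (fun _ => 0) := by
  refine (Triple.whileLoop (I := fun s : Arrays n × Fin n => s.1.inForest u = true ∧
      s.1.next = A.next) (Ψ := fun s => 1 + 4 * hopDist A.next s.2 u)
      (c := fun s => 3 + (1 + 4 * hopDist A.next (hop A.next s.2) u)) ?_ ?_ ⟨hu, rfl⟩ ?_).weaken
      le_rfl (fun _ _ => trivial) (fun _ _ => le_rfl)
  · intro s _ _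
    simp
  · rintro ⟨B, x⟩ ⟨h1, h2⟩ hc
    dsimp only at h1 h2 hc ⊢
    have hxu : x ≠ u := by
      rintro rfl
      simp [h1] at hc
    refine ⟨?_, ?_⟩
    · unfold retraceStep
      refine Triple.tick_bind (c := 3) ?_
      have := Triple.ret (a := (({ B with
          inForest := Function.update B.inForest x true
          root := Function.update B.root x r }, (B.next x).getD x) : Arrays n × Fin n))
        (Q := fun s : Arrays n × Fin n => s.1.inForest u = true ∧ s.1.next = A.next)
        (Φ := fun s => 1 + 4 * hopDist A.next s.2 u)
        ⟨by simp [Function.update_apply, h1], h2⟩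
      simpa [hop, ← h2] using this
    · calc (1 : ℝ≥0∞) + (3 + (1 + 4 * hopDist A.next (hop A.next x) u))
          = 1 + 4 * (hopDist A.next (hop A.next x) u + 1) := by ring
        _ ≤ _ := by
          gcongr
          exact hopDist_hop_add_one_le hxu
  · simp [ENNReal.mul_eq_top, hfin]

/-- The potential of the loop-erased walk from `i`: it pays for the way back from `i` to the
current node, and, while the walk goes on, the expected remaining length `a`. -/
noncomputable def walkPotential (a : ℕ) (i : Fin n) (s : Arrays n × Fin n) : ℝ≥0∞ :=
  (if s.1.inForest s.2 then 4 else (a : ℝ≥0∞)) + 4 * hopDist s.1.next i s.2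

theorem Triple_walkStep {G : WDigraph n} {a : ℕ} (ha : 4 ≤ a) (i : Fin n) (s : Arrays n × Fin n) :
    Triple (walkStep G s) ((1 / (1 + G.deg s.2) : ℝ≥0) * (1 + (7 + 4 * hopDist s.1.next i s.2))
        + (1 - 1 / (1 + G.deg s.2) : ℝ≥0) * (1 + (3 + (a + 4 * (hopDist s.1.next i s.2 + 1)))))
      (fun _ => True) (walkPotential a i) := by
  have hq : 1 / (1 + G.deg s.2) ≤ 1 := by
    rw [div_le_one (by positivity)]
    exact le_self_add
  unfold walkStep
  refine (Triple_randLE hq fun b => if b then 7 + 4 * hopDist s.1.next i s.2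
      else 3 + (a + 4 * (hopDist s.1.next i s.2 + 1))).bind ?_ |>.weaken
      (by simp) (fun _ h => h) (fun _ _ => le_rfl)
  rintro (_ | _) hb
  · have hdeg : G.deg s.2 ≠ 0 := by
      intro h0
      apply hb rfl
      simp [h0]
    have h3 : (3 : ℝ≥0∞) + (a + 4 * (hopDist s.1.next i s.2 + 1))
        = 1 + (2 + (a + 4 * (hopDist s.1.next i s.2 + 1))) := by
      rw [← add_assoc 1]; norm_num
    simp only [Bool.false_eq_true, if_false]
    rw [h3]
    refine (Triple_randomNeighbor hdeg _).bind fun v _ => ?_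
    refine Triple.tick_bind (c := 2) ?_
    refine (Triple.ret (Q := fun _ => True) (Φ := walkPotential a i) trivial).weaken ?_
      (fun _ h => h) (fun _ _ => le_rfl)
    unfold walkPotential
    dsimp only
    gcongr
    -- The walk may have entered the forest; then only 4 of the allowance `a` is kept.
    · split_ifs
      · exact_mod_cast ha
      · rfl
    · exact hopDist_update_some_le _ _ _ _
  · have h3 : (7 : ℝ≥0∞) + 4 * hopDist s.1.next i s.2
        = (3 : ℕ) + (4 + 4 * hopDist s.1.next i s.2) := by
      rw [← add_assoc]; norm_num
    simp only [if_true]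
    rw [h3]
    refine Triple.tick_bind ?_
    refine (Triple.ret (Q := fun _ => True) (Φ := walkPotential a i) trivial).weaken ?_
      (fun _ h => h) (fun _ _ => le_rfl)
    unfold walkPotential
    simp only [Function.update_self, if_true]
    gcongr
    exact hopDist_update_le _ _ _ _

/-- Test and step cost at most 5, and 4 more is stored for a new hop or for finishing. Stopping, of
probability `q`, releases `a`, so `9 ≤ q * a` suffices. The 4 kept at the end pays for the last test
here, two ticks, and the last test of the retracing. -/
theorem Triple_walk {G : WDigraph n} {a : ℕ} (hG : ∀ u, 9 ≤ 1 / (1 + G.deg u) * (a : ℝ≥0))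
    (A : Arrays n) (i : Fin n) :
    Triple (whileLoop (fun s => !s.1.inForest s.2) (walkStep G) (A, i)) (a : ℝ≥0∞)
      (fun s => s.1.inForest s.2 = true)
      (fun s => 3 + 4 * hopDist s.1.next i s.2) := by
  have hq : ∀ u, 1 / (1 + G.deg u) ≤ 1 := fun u => by
    rw [div_le_one (by positivity)]
    exact le_self_add
  have ha : 9 ≤ a := by
    have : (9 : ℝ≥0) ≤ a := (hG i).trans (mul_le_of_le_one_left' (hq i))
    exact_mod_cast this
  have hpot : walkPotential a i (A, i) ≤ a := by
    simp only [walkPotential, hopDist_self, mul_zero, add_zero]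
    split_ifs
    · exact_mod_cast (by omega : 4 ≤ a)
    · rfl
  refine (Triple.whileLoop (I := fun _ => True) (Ψ := walkPotential a i)
    (c := fun s => (1 / (1 + G.deg s.2) : ℝ≥0) * (1 + (7 + 4 * hopDist s.1.next i s.2))
        + (1 - 1 / (1 + G.deg s.2) : ℝ≥0) * (1 + (3 + (a + 4 * (hopDist s.1.next i s.2 + 1)))))
    ?_ ?_ trivial (ne_top_of_le_ne_top (by simp) hpot)).weaken hpot ?_ fun _ _ => le_rfl
  · intro s _ hs
    have hs' : s.1.inForest s.2 = true := by simpa using hs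
    rw [walkPotential, if_pos hs', ← add_assoc]
    norm_num
  · intro s _ hs
    refine ⟨Triple_walkStep (by omega) i s, ?_⟩
    have hs' : ¬ s.1.inForest s.2 = true := by simpa using hs
    rw [walkPotential, if_neg hs']
    set q : ℝ≥0 := 1 / (1 + G.deg s.2) with hq_def
    generalize hopDist s.1.next i s.2 = d
    have h1 : (q : ℝ≥0∞) + (1 - q : ℝ≥0) = 1 := by
      exact_mod_cast add_tsub_cancel_of_le (hq s.2)
    have h9 : (9 : ℝ≥0∞) ≤ q * a := by exact_mod_cast hG s.2
    calc (1 : ℝ≥0∞) + (q * (1 + (7 + 4 * d)) + (1 - q : ℝ≥0) * (1 + (3 + (a + 4 * (d + 1)))))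
        = 1 + (q + (1 - q : ℝ≥0)) * (8 + 4 * d) + (1 - q : ℝ≥0) * a := by ring
      _ = 9 + (1 - q : ℝ≥0) * a + 4 * d := by rw [h1]; ring
      _ ≤ q * a + (1 - q : ℝ≥0) * a + 4 * d := by gcongr
      _ = a + 4 * d := by rw [← add_mul, h1, one_mul]
  · intro s hs
    simpa using hs.2

theorem Spec_branch {G : WDigraph n} {a : ℕ} (hG : ∀ u, 9 ≤ 1 / (1 + G.deg u) * (a : ℝ≥0))
    (A : Arrays n) (i : Fin n) : Spec (branch G A i) (1 + a) fun _ => True := by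
  unfold branch
  refine Spec.tick_bind ?_
  have hw := Triple_walk hG A i
  -- An outcome of positive probability has finite potential because the expectation is finite; so
  -- the start is linked to the end of the walk.
  have hw' : Triple (whileLoop (fun s => !s.1.inForest s.2) (walkStep G) (A, i)) (a : ℝ≥0∞)
      (fun s => s.1.inForest s.2 = true ∧ hopDist s.1.next i s.2 ≠ ⊤)
      (fun s => 3 + 4 * hopDist s.1.next i s.2) := by
    refine ⟨hw.halts, hw.cost, fun x hx => ⟨hw.post x hx, fun htop => ?_⟩⟩
    have h1 := ENNReal.ne_top_of_tsum_ne_top (ne_top_of_le_ne_top (by simp) hw.cost) x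
    simp [htop, ENNReal.mul_top, hx] at h1
  refine hw'.bind fun s hs => ?_
  have h3 : (3 : ℝ≥0∞) + 4 * hopDist s.1.next i s.2
      = (2 : ℕ) + (1 + 4 * hopDist s.1.next i s.2) := by
    rw [← add_assoc]; norm_num
  rw [h3]
  refine Triple.tick_bind ?_
  exact (Triple_retrace hs.1 hs.2).bind fun s' _ => Triple.ret (Φ := fun _ => 0) trivial

theorem Spec_randomForest {G : WDigraph n} {a : ℕ}
    (hG : ∀ u, 9 ≤ 1 / (1 + G.deg u) * (a : ℝ≥0)) :
    Spec (randomForest G) (3 * n + n * (1 + a)) fun _ => True := by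
  unfold randomForest
  refine Spec.tick_bind ?_
  refine Spec.weaken (c := (List.finRange n).length * (1 + a) + 0) ?_ (by simp) fun _ h => h
  exact (Spec.foldlM_const (fun _ _ => True) trivial fun _ i _ A _ _ => Spec_branch hG A i).bind
    fun _ _ => Spec.ret trivial

/-! ## The reweighted graph -/

/-- The graph with weights `w(i, j) / (α / (1 - α) * d_i)`. -/
noncomputable def WDigraph.reweighted (α : ℝ≥0) (G : WDigraph n) : WDigraph n where
  w := fun i j => G.w i j / (α / (1 - α) * G.deg i)

theorem WDigraph.mem_nbrs {G : WDigraph n} {i j : Fin n} : j ∈ G.nbrs i ↔ G.w i j ≠ 0 := by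
  simp [WDigraph.nbrs]

theorem WDigraph.length_nbrs (G : WDigraph n) (i : Fin n) :
    (G.nbrs i).length = (Finset.univ.filter fun j => G.w i j ≠ 0).card := by
  rw [WDigraph.nbrs, ← List.toFinset_card_of_nodup ((List.nodup_finRange n).filter _)]
  congr 1
  ext j
  simp

theorem WDigraph.numEdges_eq_sum (G : WDigraph n) :
    G.numEdges = ((List.finRange n).map fun i => (G.nbrs i).length).sum := by
  rw [← Fin.sum_univ_def]
  simp_rw [WDigraph.length_nbrs, WDigraph.numEdges, Finset.card_filter]
  exact Fintype.sum_prod_type _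

theorem sum_map_add_mul_length_nbrs (G : WDigraph n) (c d : ℕ) :
    ((List.finRange n).map fun i => c + d * (G.nbrs i).length).sum = c * n + d * G.numEdges := by
  rw [WDigraph.numEdges_eq_sum, List.sum_map_add, List.sum_map_mul_left]
  simp [mul_comm]

theorem Spec_buildReweighted (α : ℝ≥0) (G : WDigraph n) :
    Spec (buildReweighted α G) (n + 3 * G.numEdges) fun Gr => Gr = G.reweighted α := by
  refine Spec.weaken (Spec.foldlM (c := fun i => 1 + 3 * (G.nbrs i).length)
    (fun l Gr => ∀ x y, Gr.w x y = if x ∈ l then (G.reweighted α).w x y else 0) (by simp) ?_)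
    (by rw [sum_map_add_mul_length_nbrs, one_mul]) ?_
  · intro l₁ i l₂ Gr _ hGr
    refine Spec.tick_bind ?_
    refine Spec.weaken (Spec.foldlM_const (c := 3) (fun l (Gr : WDigraph n) => ∀ x y, Gr.w x y =
      if x ∈ l₁ ∨ (x = i ∧ y ∈ l) then (G.reweighted α).w x y else 0) (by simpa using hGr) ?_)
      (by rw [mul_comm]) ?_
    · intro m₁ j m₂ Gr' _ h
      refine Spec.tick_ret fun x y => ?_
      simp only [WDigraph.setWeight, h, List.mem_append, List.mem_singleton]
      by_cases hxy : x = i ∧ y = j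
      · obtain ⟨rfl, rfl⟩ := hxy
        simp [WDigraph.reweighted]
      · rw [if_neg hxy]
        congr 1
        grind
    · intro Gr' h x y
      rw [h]
      -- Non-edges are never written, but their target weight is the initial value 0.
      by_cases hw : G.w x y = 0
      · simp [WDigraph.reweighted, hw]
      · congr 1
        simp only [List.mem_append, List.mem_singleton, WDigraph.mem_nbrs]
        grind
  · rintro ⟨w⟩ h
    rw [WDigraph.reweighted, WDigraph.mk.injEq]
    funext x y
    simpa [WDigraph.reweighted] using h x y

/-- The walk on the reweighted graph stops in each step with probability at least `α`. -/
theorem le_rootProb_reweighted {α : ℝ≥0} (hα0 : 0 < α) (hα1 : α < 1) (G : WDigraph n) (u : Fin n) :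
    α ≤ 1 / (1 + (G.reweighted α).deg u) := by
  have h1 : 0 < 1 - α := tsub_pos_of_lt hα1
  have h2 : α + (1 - α) = 1 := add_tsub_cancel_of_le hα1.le
  have hdeg : (G.reweighted α).deg u ≤ (1 - α) / α := by
    have : (G.reweighted α).deg u = G.deg u / (α / (1 - α) * G.deg u) := by
      simp only [WDigraph.deg, WDigraph.reweighted]
      rw [Finset.sum_div]
    rw [this]
    -- At a sink the quotient is `0 / 0 = 0`; elsewhere the bound is an equality.
    by_cases h0 : G.deg u = 0
    · simp [h0]
    · refine le_of_eq ?_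
      field_simp
  rw [le_div_iff₀ (by positivity)]
  calc α * (1 + (G.reweighted α).deg u) ≤ α * (1 + (1 - α) / α) := by gcongr
    _ = α + (1 - α) := by field_simp
    _ = 1 := h2

/-! ## Counting -/

theorem Spec_countNodes (S : Finset (Fin n)) (root : Fin n → Fin n) (T : Tally n) :
    Spec ((List.finRange n).foldlM (countNode S root) T) (4 * n) fun T' =>
      T'.roots = T.roots ∧
      (∀ s, T'.cσ s = T.cσ s + (Finset.univ.filter fun u => root u = s).card) ∧
      ∀ v, T'.cη v = T.cη v + if root v ∈ S then 1 else 0 := by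
  refine Spec.weaken (Spec.foldlM_const (c := 4) (fun l (T' : Tally n) =>
      T'.roots = T.roots ∧
      (∀ s, T'.cσ s = T.cσ s + l.countP fun u => root u = s) ∧
      ∀ v, T'.cη v = T.cη v + if root v ∈ S then l.count v else 0) (by simp) ?_)
      (by simp [mul_comm]) ?_
  · rintro l₁ j l₂ T' _ ⟨h1, h2, h3⟩
    refine Spec.tick_ret ⟨h1, fun s => ?_, fun v => ?_⟩
    · simp only [Function.update_apply, h2, List.countP_append, List.countP_singleton]
      by_cases hs : s = root j
      · simp [hs, add_assoc]
      · simp [hs, Ne.symm hs]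
    · by_cases hj : root j ∈ S
      · simp only [hj, if_true, Function.update_apply, h3, List.count_append, List.count_singleton]
        by_cases hv : v = j
        · simp [hv, hj, add_assoc]
        · simp [hv, Ne.symm hv]
      · simp only [hj, if_false, h3, List.count_append, List.count_singleton]
        by_cases hv : v = j
        · simp [hv, hj]
        · simp [Ne.symm hv]
  · rintro T' ⟨h1, h2, h3⟩
    refine ⟨h1, fun s => ?_, fun v => ?_⟩
    · rw [h2, List.countP_eq_length_filter,
        ← List.toFinset_card_of_nodup ((List.nodup_finRange n).filter _)]
      congr 2
      ext u
      simp
    · rw [h3, List.count_eq_one_of_mem (List.nodup_finRange n) (List.mem_finRange v)]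

/-- The tally `T` has counted the forests of `T.roots`, which are `ψ` in number. -/
structure Tally.Correct (S : Finset (Fin n)) (ψ : ℕ) (T : Tally n) : Prop where
  length : T.roots.length = ψ
  cσ_eq : ∀ s, T.cσ s = (T.roots.map fun r => (Finset.univ.filter fun u => r u = s).card).sum
  cη_eq : ∀ v, T.cη v = (T.roots.map fun r => if r v ∈ S then 1 else 0).sum

theorem Spec_sample (S : Finset (Fin n)) {Gr : WDigraph n} {a : ℕ}
    (hG : ∀ u, 9 ≤ 1 / (1 + Gr.deg u) * (a : ℝ≥0)) (ψ : ℕ) :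
    Spec (sample S Gr ψ) (2 * n + ψ * (1 + (a + 8) * n)) (Tally.Correct S ψ) := by
  unfold sample
  refine Spec.tick_bind ?_
  refine Spec.weaken (Spec.foldlM_const (c := 1 + (a + 8) * n)
    (fun l T => Tally.Correct S l.length T) ⟨rfl, by simp, by simp⟩ ?_) (by simp) (by simp)
  rintro l₁ _ l₂ T _ hT
  unfold sampleOnce
  refine Spec.tick_bind ?_
  -- Per node: 3 for initialising the arrays, `1 + a` for its branch, 4 for counting.
  refine Spec.weaken (c := 3 * n + n * (1 + a) + (4 * n + 0)) ?_ (le_of_eq (by ring)) fun _ h => h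
  refine (Spec_randomForest hG).bind fun root _ => ?_
  refine (Spec_countNodes S root T).bind fun T' hT' => Spec.ret ?_
  obtain ⟨h1, h2, h3⟩ := hT'
  refine ⟨?_, fun s => ?_, fun v => ?_⟩
  · simp [h1, hT.length]
  · simp [h1, h2, hT.cσ_eq]
  · simp [h1, h3, hT.cη_eq]

theorem Tally.Correct.sigma {S : Finset (Fin n)} {ψ : ℕ} {T : Tally n} (h : T.Correct S ψ)
    (s : Fin n) : (T.cσ s : ℝ) / (n * ψ) = sigmaEst ψ T.roots s := by
  rw [sigmaEst, h.cσ_eq, Nat.cast_list_sum, List.map_map]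
  rfl

theorem Tally.Correct.eta {S : Finset (Fin n)} {ψ : ℕ} {T : Tally n} (h : T.Correct S ψ)
    (v : Fin n) : (T.cη v : ℝ) / ψ = etaEst S ψ T.roots v := by
  rw [etaEst, h.cη_eq, Nat.cast_list_sum, List.map_map]
  congr 3
  funext r
  simp

theorem Tally.Correct.le {S : Finset (Fin n)} {ψ : ℕ} {T : Tally n} (h : T.Correct S ψ)
    (v : Fin n) : T.cη v ≤ ψ := by
  rw [h.cη_eq, ← h.length]
  refine (List.sum_le_card_nsmul _ 1 ?_).trans (by simp)
  intro x hx
  obtain ⟨r, -, rfl⟩ := List.mem_map.mp hx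
  split_ifs <;> simp

/-! ## The top nodes -/

theorem Spec_findDmax (G : WDigraph n) : Spec (findDmax G) (2 * n) fun d => d = G.dmax := by
  refine Spec.weaken (Spec.foldlM_const (c := 2)
    (fun l (d : ℝ≥0) => d = l.toFinset.sup G.deg) (by simp) ?_) (by simp [mul_comm]) ?_
  · rintro l₁ i l₂ d _ rfl
    refine Spec.tick_ret ?_
    rw [List.toFinset_append, Finset.sup_union]
    simp
  · rintro d rfl
    simp [WDigraph.dmax]

/-- The nodes of count `v`, in the order in which the bucket sort leaves them. -/
def bucket (c : Fin n → ℕ) (v : ℕ) : List (Fin n) :=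
  ((List.finRange n).filter fun j => c j = v).reverse

/-- The nodes of count at most `ψ`, sorted by decreasing count. -/
def sortedNodes (ψ : ℕ) (c : Fin n → ℕ) : List (Fin n) :=
  (List.range (ψ + 1)).reverse.flatMap (bucket c)

theorem mem_bucket {c : Fin n → ℕ} {v : ℕ} {j : Fin n} : j ∈ bucket c v ↔ c j = v := by
  simp [bucket]

theorem mem_sortedNodes {ψ : ℕ} {c : Fin n → ℕ} (hc : ∀ j, c j ≤ ψ) (j : Fin n) :
    j ∈ sortedNodes ψ c := by
  simp [sortedNodes, mem_bucket, hc]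

theorem nodup_sortedNodes (ψ : ℕ) (c : Fin n → ℕ) : (sortedNodes ψ c).Nodup := by
  rw [sortedNodes, List.nodup_flatMap]
  refine ⟨fun v _ => List.nodup_reverse.mpr ((List.nodup_finRange n).filter _), ?_⟩
  refine (List.nodup_reverse.mpr List.nodup_range).imp fun {v w} hvw => ?_
  intro j hv hw
  exact hvw ((mem_bucket.mp hv).symm.trans (mem_bucket.mp hw))

theorem pairwise_sortedNodes (ψ : ℕ) (c : Fin n → ℕ) :
    (sortedNodes ψ c).Pairwise fun u v => c v ≤ c u := by
  rw [sortedNodes, List.pairwise_flatMap]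
  refine ⟨fun v _ => List.pairwise_of_forall_mem_list fun x hx y hy => ?_, ?_⟩
  · rw [mem_bucket.mp hx, mem_bucket.mp hy]
  · rw [List.pairwise_reverse]
    refine List.pairwise_lt_range.imp fun {v w} hvw x hx y hy => ?_
    rw [mem_bucket.mp hx, mem_bucket.mp hy]
    exact hvw.le

theorem length_sortedNodes {ψ : ℕ} {c : Fin n → ℕ} (hc : ∀ j, c j ≤ ψ) :
    (sortedNodes ψ c).length = n := by
  rw [← List.toFinset_card_of_nodup (nodup_sortedNodes ψ c)]
  have : (sortedNodes ψ c).toFinset = Finset.univ := by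
    ext j
    simp [mem_sortedNodes hc]
  rw [this, Finset.card_fin]

/-- Prepending to a list until its length reaches `m` produces the reversed prefix of length `m`;
this is the invariant step of the collecting loop. -/
theorem reverse_take_append_singleton {α : Type*} (P : List α) (u : α) (m : ℕ) :
    ((P ++ [u]).take m).reverse
      = if (P.take m).reverse.length < m then u :: (P.take m).reverse else (P.take m).reverse := by
  by_cases h : P.length < m
  · rw [List.take_of_length_le (by simp; omega), List.take_of_length_le h.le]
    simp [h]
  · rw [List.take_append_of_le_length (by omega), if_neg (by simp; omega)]

theorem Spec_topNodes {ψ : ℕ} {c : Fin n → ℕ} (hc : ∀ j, c j ≤ ψ) (d : ℝ≥0) :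
    Spec (topNodes ψ c d) (2 * (ψ + 1) + 5 * n)
      fun K => K = ((sortedNodes ψ c).take ⌈d⌉₊).reverse := by
  unfold topNodes
  have hsum : ((List.range (ψ + 1)).reverse.map fun v => 1 + 3 * (bucket c v).length).sum
      = ψ + 1 + 3 * n := by
    have h := length_sortedNodes hc
    rw [sortedNodes, List.length_flatMap] at h
    rw [List.sum_map_add, List.sum_map_mul_left, h]
    simp
  refine Spec.weaken (c := ψ + 1 + (2 * n + (ψ + 1 + 3 * n))) ?_ (by omega) fun _ h => h
  refine Spec.tick_bind ?_
  refine Spec.bind (Q := fun B => B = bucket c) ?_ ?_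
  · refine Spec.weaken (Spec.foldlM_const (c := 2) (fun l (B : ℕ → List (Fin n)) =>
      B = fun v => (l.filter fun j => c j = v).reverse) (by simp) ?_) (by simp [mul_comm]) ?_
    · rintro l₁ j l₂ B _ rfl
      refine Spec.tick_ret ?_
      funext v
      by_cases hv : v = c j
      · subst hv
        simp
      · simp [hv, Ne.symm hv]
    · rintro B rfl
      rfl
  · rintro _ rfl
    refine Spec.weaken (Spec.foldlM (c := fun v => 1 + 3 * (bucket c v).length)
      (fun l (K : List (Fin n)) => K = ((l.flatMap (bucket c)).take ⌈d⌉₊).reverse) (by simp) ?_)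
      hsum.le fun _ h => h
    rintro l₁ v l₂ _ _ rfl
    refine Spec.tick_bind ?_
    refine Spec.weaken (Spec.foldlM_const (c := 3) (fun l (K : List (Fin n)) =>
      K = ((l₁.flatMap (bucket c) ++ l).take ⌈d⌉₊).reverse) (by simp) ?_) (by rw [mul_comm]) ?_
    · rintro m₁ u m₂ K _ rfl
      refine Spec.tick_ret ?_
      rw [← List.append_assoc, reverse_take_append_singleton]
      -- For natural lengths, being below `d` and being below `⌈d⌉₊` agree.
      simp only [Nat.lt_ceil]
    · rintro K rfl
      simp

/-- A prefix of the list sorted by decreasing count; whatever is outside the prefix comes later in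
the list. -/
theorem isTopSet_sortedNodes {ψ : ℕ} {c : Fin n → ℕ} (hc : ∀ j, c j ≤ ψ) (d : ℝ≥0)
    {η : Fin n → ℝ} (hη : ∀ u v, c v ≤ c u → η v ≤ η u) :
    IsTopSet d η ((sortedNodes ψ c).take ⌈d⌉₊).reverse.toFinset := by
  have hnd := nodup_sortedNodes ψ c
  refine ⟨?_, fun u hu v hv => hη u v ?_⟩
  · rw [List.toFinset_card_of_nodup (List.nodup_reverse.mpr (hnd.sublist (List.take_sublist _ _)))]
    simp [length_sortedNodes hc, min_comm]
  · simp only [List.mem_toFinset, List.mem_reverse] at hu hv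
    have hv' : v ∈ (sortedNodes ψ c).drop ⌈d⌉₊ := by
      have := mem_sortedNodes hc v
      rw [← List.take_append_drop ⌈d⌉₊ (sortedNodes ψ c), List.mem_append] at this
      exact this.resolve_left hv
    have hp := pairwise_sortedNodes ψ c
    rw [← List.take_append_drop ⌈d⌉₊ (sortedNodes ψ c), List.pairwise_append] at hp
    exact hp.2.2 u hu v hv'

/-! ## The best rewiring -/

/-- `best` maximises `f` over `P`; it is `none` only if `P` is empty. -/
def IsBest {ι : Type*} (f : ι → ℝ) (P : ι → Prop) : Option ι → Prop
  | none => ∀ c, ¬ P c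
  | some c => P c ∧ ∀ c', P c' → f c' ≤ f c

theorem IsBest.congr {ι : Type*} {f : ι → ℝ} {P P' : ι → Prop} {o : Option ι}
    (h : IsBest f P o) (hP : ∀ c, P' c ↔ P c) : IsBest f P' o := by
  rwa [show P' = P from funext fun c => propext (hP c)]

/-- One comparison of the scan: `q` says whether `x` is admissible, and a tie keeps the old
maximiser. -/
theorem IsBest.step {ι : Type*} {f : ι → ℝ} {P P' : ι → Prop} {o : Option ι} {x : ι} {q : Prop}
    [Decidable (q ∧ ∀ c ∈ o, f c < f x)] (h : IsBest f P o) (hP : ∀ c, P' c ↔ P c ∨ (q ∧ c = x)) :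
    IsBest f P' (if q ∧ ∀ c ∈ o, f c < f x then some x else o) := by
  split_ifs with hif
  · refine ⟨(hP x).mpr (Or.inr ⟨hif.1, rfl⟩), fun c' hc' => ?_⟩
    rcases (hP c').mp hc' with h' | ⟨-, rfl⟩
    · cases o with
      | none => exact absurd h' (h c')
      | some c => exact (h.2 c' h').trans (hif.2 c rfl).le
    · rfl
  · cases o with
    | none =>
      intro c hc
      rcases (hP c).mp hc with h' | ⟨hq, -⟩
      · exact h c h'
      · exact hif ⟨hq, by simp⟩
    | some c =>
      refine ⟨(hP c).mpr (Or.inl h.1), fun c' hc' => ?_⟩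
      rcases (hP c').mp hc' with h' | ⟨hq, rfl⟩
      · exact h.2 c' h'
      · by_contra! hlt
        exact hif ⟨hq, by simpa using hlt⟩

theorem Spec_setMarks (G : WDigraph n) (i : Fin n) (v : Bool) (mark : Fin n → Bool) :
    Spec (setMarks G i v mark) (G.nbrs i).length
      fun mark' => ∀ k, mark' k = if G.w i k ≠ 0 then v else mark k := by
  refine Spec.weaken (Spec.foldlM_const (c := 1) (fun l (mark' : Fin n → Bool) =>
    ∀ k, mark' k = if k ∈ l then v else mark k) (by simp) ?_) (by simp) ?_
  · intro l₁ j l₂ mark' _ h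
    refine Spec.tick_ret fun k => ?_
    by_cases hk : k = j
    · simp [hk]
    · simp [hk, h]
  · intro mark' h k
    simp only [h, WDigraph.mem_nbrs]

theorem Spec_scanEdge (f : Fin n × Fin n × Fin n → ℝ) (K : List (Fin n)) (mark : Fin n → Bool)
    (i : Fin n) {best : Option (Fin n × Fin n × Fin n)} (j : Fin n)
    {P : Fin n × Fin n × Fin n → Prop} (hbest : IsBest f P best) :
    Spec (scanEdge f K mark i best j) (10 * K.length) (IsBest f fun c => P c ∨
      (c.1 = i ∧ c.2.1 = j ∧ c.2.2 ∈ K ∧ c.2.2 ≠ i ∧ mark c.2.2 = false)) := by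
  unfold scanEdge
  refine Spec.weaken (Spec.foldlM_const (c := 10) (fun l best => IsBest f (fun c => P c ∨
      (c.1 = i ∧ c.2.1 = j ∧ c.2.2 ∈ l ∧ c.2.2 ≠ i ∧ mark c.2.2 = false)) best) ?_ ?_)
      (by rw [mul_comm]) fun _ h => h
  · exact hbest.congr (by simp)
  · intro l₁ k l₂ best _ h
    refine Spec.tick_ret ?_
    simp only [← and_assoc]
    refine IsBest.step h ?_
    rintro ⟨x, y, z⟩
    simp only [List.mem_append, List.mem_singleton, Prod.mk.injEq]
    grind

theorem Spec_findBest (G : WDigraph n) (f : Fin n × Fin n × Fin n → ℝ) (K : List (Fin n)) :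
    Spec (findBest G f K) (2 * n + (3 + 10 * K.length) * G.numEdges)
      (IsBest f (· ∈ G.candidates K.toFinset)) := by
  unfold findBest
  refine Spec.weaken (c := n + ((n + (3 + 10 * K.length) * G.numEdges) + 0)) ?_ (by omega)
    fun _ h => h
  refine Spec.tick_bind ?_
  refine Spec.bind (Q := fun s => IsBest f (· ∈ G.candidates K.toFinset) s.2) ?_
    fun s hs => Spec.ret hs
  -- The marks are clear between rows, so within a row they show exactly its out-neighbours. An edge
  -- costs two mark updates, one tick and 10 per member of `K`.
  refine Spec.weaken (Spec.foldlM (c := fun i => 1 + (3 + 10 * K.length) * (G.nbrs i).length)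
    (fun l (s : (Fin n → Bool) × Option (Fin n × Fin n × Fin n)) => (∀ k, s.1 k = false) ∧
      IsBest f (fun c => c ∈ G.candidates K.toFinset ∧ c.1 ∈ l) s.2) ⟨by simp, by simp [IsBest]⟩ ?_)
    (by rw [sum_map_add_mul_length_nbrs, one_mul]) ?_
  · rintro l₁ i l₂ ⟨mark, best⟩ _ ⟨hmark, hbest⟩
    dsimp only at hmark hbest
    refine Spec.tick_bind ?_
    refine Spec.weaken (c := (G.nbrs i).length + ((G.nbrs i).length * (1 + 10 * K.length)
      + ((G.nbrs i).length + 0))) ?_ (le_of_eq (by ring)) fun _ h => h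
    refine (Spec_setMarks G i true mark).bind fun mark' hmark' => ?_
    have hm : ∀ k, mark' k = false ↔ G.w i k = 0 := by
      intro k
      by_cases hk : G.w i k = 0 <;> simp [hmark', hk, hmark]
    refine Spec.bind (Spec.foldlM_const (c := 1 + 10 * K.length) (fun l best => IsBest f
      (fun c => (c ∈ G.candidates K.toFinset ∧ c.1 ∈ l₁) ∨
        (c.1 = i ∧ c.2.1 ∈ l ∧ c.2.2 ∈ K ∧ c.2.2 ≠ i ∧ mark' c.2.2 = false)) best)
        (hbest.congr (by simp)) ?_) ?_
    · intro m₁ j m₂ best' _ h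
      refine Spec.tick_bind ?_
      refine Spec.weaken (Spec_scanEdge f K mark' i j h) le_rfl fun o ho => ho.congr ?_
      rintro ⟨x, y, z⟩
      simp only [List.mem_append, List.mem_singleton]
      grind
    · intro best' hbest'
      refine (Spec_setMarks G i false mark').bind fun mark'' hmark'' => Spec.ret ⟨fun k => ?_, ?_⟩
      · by_cases hk : G.w i k = 0
        · simp [hmark'', hk, hm]
        · simp [hmark'', hk]
      · refine hbest'.congr ?_
        rintro ⟨x, y, z⟩
        simp only [List.mem_append, List.mem_singleton, WDigraph.mem_nbrs, hm,
          WDigraph.candidates, WDigraph.IsRewiring, WDigraph.Edge, Set.mem_ofPred_eq,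
          List.mem_toFinset]
        grind
  · rintro s ⟨-, hs⟩
    exact hs.congr (by simp)

/-! ## Rewirings preserve degrees -/

/-- The same out-degrees and numbers of out-neighbours. -/
structure WDigraph.SameDegrees (G G' : WDigraph n) : Prop where
  deg_eq : ∀ i, G'.deg i = G.deg i
  length_eq : ∀ i, (G'.nbrs i).length = (G.nbrs i).length

namespace WDigraph

theorem SameDegrees.refl (G : WDigraph n) : G.SameDegrees G := ⟨fun _ => rfl, fun _ => rfl⟩

theorem SameDegrees.trans {G₁ G₂ G₃ : WDigraph n} (h : G₁.SameDegrees G₂)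
    (h' : G₂.SameDegrees G₃) : G₁.SameDegrees G₃ :=
  ⟨fun i => (h'.deg_eq i).trans (h.deg_eq i), fun i => (h'.length_eq i).trans (h.length_eq i)⟩

theorem SameDegrees.dmax_eq {G G' : WDigraph n} (h : G.SameDegrees G') : G'.dmax = G.dmax := by
  rw [dmax, dmax, funext h.deg_eq]

theorem SameDegrees.numEdges_eq {G G' : WDigraph n} (h : G.SameDegrees G') :
    G'.numEdges = G.numEdges := by
  simp only [numEdges_eq_sum, h.length_eq]

/-- A rewiring swaps two entries of a row of the adjacency matrix. -/
theorem rewire_w {G : WDigraph n} {c : Fin n × Fin n × Fin n} (hc : G.IsRewiring c) (x y : Fin n) :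
    (G.rewire c).w x y = G.w x ((if x = c.1 then Equiv.swap c.2.1 c.2.2 else 1) y) := by
  obtain ⟨i, j, k⟩ := c
  obtain ⟨h1, h2, -⟩ := hc
  simp only [Edge, not_not, ne_eq] at h1 h2
  have hjk : j ≠ k := by
    rintro rfl
    exact h1 h2
  simp only [rewire, setWeight]
  by_cases hx : x = i
  · subst hx
    by_cases hj : y = j
    · simp [hj, h2]
    · by_cases hk : y = k
      · simp [hk, hjk.symm]
      · simp [hj, hk, Equiv.swap_apply_of_ne_of_ne hj hk]
  · simp [hx]

/-- Both quantities are sums over a row, hence invariant under permuting its entries. -/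
theorem sameDegrees_rewire {G : WDigraph n} {c : Fin n × Fin n × Fin n} (hc : G.IsRewiring c) :
    G.SameDegrees (G.rewire c) := by
  refine ⟨fun x => ?_, fun x => ?_⟩
  · simp only [deg, rewire_w hc]
    exact Equiv.sum_comp _ (G.w x)
  · simp only [length_nbrs, rewire_w hc, Finset.card_filter]
    exact Equiv.sum_comp _ fun y => if G.w x y ≠ 0 then 1 else 0

theorem length_nbrs_le (G : WDigraph n) (i : Fin n) : (G.nbrs i).length ≤ n := by
  simpa [nbrs] using List.length_filter_le (fun j => decide (G.w i j ≠ 0)) (List.finRange n)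

/-- Lets the terms linear in `m` be absorbed: the ceiling vanishes only for a graph without edges.
-/
theorem numEdges_le_mul_ceil_dmax (G : WDigraph n) : G.numEdges ≤ G.numEdges * ⌈G.dmax⌉₊ := by
  by_cases h : ⌈G.dmax⌉₊ = 0
  · have hd : G.dmax = 0 := by simpa using h
    have hw : ∀ i j, G.w i j = 0 := by
      intro i j
      have h1 : G.deg i ≤ G.dmax := Finset.le_sup (Finset.mem_univ i)
      have h2 : G.w i j ≤ G.deg i := Finset.single_le_sum (fun _ _ => zero_le) (Finset.mem_univ j)
      exact le_antisymm (h2.trans (h1.trans hd.le)) zero_le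
    simp [numEdges, hw]
  · exact Nat.le_mul_of_pos_right _ (Nat.pos_of_ne_zero h)

/-- A node with few out-neighbours has a rewiring with new end point in `K`. -/
theorem candidates_nonempty {G : WDigraph n} {K : Finset (Fin n)} {i : Fin n}
    (h0 : 0 < (G.nbrs i).length) (hK : (G.nbrs i).length + 1 < K.card) :
    (G.candidates K).Nonempty := by
  obtain ⟨j, hj⟩ := List.exists_mem_of_length_pos h0
  rw [mem_nbrs] at hj
  have hlt : (insert i (G.nbrs i).toFinset).card < K.card :=
    ((Finset.card_insert_le _ _).trans
      (Nat.add_le_add_right (List.toFinset_card_le _) 1)).trans_lt hK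
  obtain ⟨k, hk, hk'⟩ := Finset.exists_mem_notMem_of_card_lt_card hlt
  simp only [Finset.mem_insert, List.mem_toFinset, mem_nbrs, not_or, not_not] at hk'
  exact ⟨(i, j, k), ⟨hj, not_not.mpr hk'.2, Ne.symm hk'.1⟩, hk⟩

end WDigraph

/-! ## Runs -/

theorem IsGreedyRound.sameDegrees {α : ℝ≥0} {S : Finset (Fin n)} {ψ : ℕ} {G : WDigraph n}
    {r : Round n} (h : IsGreedyRound α S ψ G r) : G.SameDegrees (G.rewireOpt r.choice) := by
  obtain ⟨-, -, h⟩ := h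
  cases hr : r.choice with
  | none => exact WDigraph.SameDegrees.refl G
  | some c =>
    rw [hr] at h
    exact WDigraph.sameDegrees_rewire h.1.1

/-- The graph that the rounds of a trace leave. -/
def graphAfter (G : WDigraph n) (rs : List (Round n)) : WDigraph n :=
  rs.foldl (fun G r => G.rewireOpt r.choice) G

theorem IsGreedyRun.append_singleton {α : ℝ≥0} {S : Finset (Fin n)} {ψ : ℕ} {G : WDigraph n}
    {rs : List (Round n)} {r : Round n} (h : IsGreedyRun α S ψ G rs)
    (hr : IsGreedyRound α S ψ (graphAfter G rs) r) : IsGreedyRun α S ψ G (rs ++ [r]) := by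
  induction rs generalizing G with
  | nil => exact ⟨hr, trivial⟩
  | cons r' rs ih => exact ⟨h.1, ih h.2 hr⟩

theorem IsGreedyRun.sameDegrees {α : ℝ≥0} {S : Finset (Fin n)} {ψ : ℕ} {G : WDigraph n}
    {rs : List (Round n)} (h : IsGreedyRun α S ψ G rs) : G.SameDegrees (graphAfter G rs) := by
  induction rs generalizing G with
  | nil => exact WDigraph.SameDegrees.refl G
  | cons r rs ih => exact h.1.sameDegrees.trans (ih h.2)

theorem IsGreedyRun.length_filterMap {α : ℝ≥0} {S : Finset (Fin n)} {ψ : ℕ} {G : WDigraph n}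
    {rs : List (Round n)} (h : IsGreedyRun α S ψ G rs) (hc : AlwaysCandidates G rs) :
    (rs.filterMap Round.choice).length = rs.length := by
  induction rs generalizing G with
  | nil => rfl
  | cons r rs ih =>
    obtain ⟨⟨-, -, h1⟩, h2⟩ := h
    cases hr : r.choice with
    | none =>
      rw [hr] at h1
      exact absurd h1 hc.1.ne_empty
    | some c =>
      rw [List.filterMap_cons_some hr, List.length_cons, List.length_cons, ih h2 hc.2]

theorem IsGreedyRun.alwaysCandidates {α : ℝ≥0} {S : Finset (Fin n)} {ψ : ℕ} {G : WDigraph n}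
    {rs : List (Round n)} (h : IsGreedyRun α S ψ G rs) {i : Fin n}
    (h0 : 0 < (G.nbrs i).length) (hi : (G.nbrs i).length + 1 < min n ⌈G.dmax⌉₊) :
    AlwaysCandidates G rs := by
  induction rs generalizing G with
  | nil => trivial
  | cons r rs ih =>
    have hs := h.1.sameDegrees
    refine ⟨WDigraph.candidates_nonempty h0 ?_, ih h.2 ?_ ?_⟩
    · rw [h.1.2.1.1]
      exact hi
    · rwa [hs.length_eq]
    · rwa [hs.length_eq, hs.dmax_eq]

/-! ## The algorithm -/

/-- `s'` results from `s` by a greedy round. -/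
def IsRoundStep (α : ℝ≥0) (S : Finset (Fin n)) (ψ : ℕ) (s s' : FastState n) : Prop :=
  ∃ r, IsGreedyRound α S ψ s.graph r ∧ s'.trace = s.trace ++ [r] ∧
    s'.graph = s.graph.rewireOpt r.choice ∧ s'.R = s.R ++ r.choice.toList

theorem Spec_fastRound {α : ℝ≥0} (hα0 : 0 < α) (hα1 : α < 1) {a : ℕ} (ha : 9 ≤ α * (a : ℝ≥0))
    (hn : 0 < n) (S : Finset (Fin n)) {ψ : ℕ} (hψ : 0 < ψ) (s : FastState n) :
    Spec (fastRound α S ψ s)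
      ((a + 40) * (n * ψ + s.graph.numEdges * ⌈s.graph.dmax⌉₊)) (IsRoundStep α S ψ s) := by
  set G := s.graph with hG
  set m := G.numEdges
  set D := ⌈G.dmax⌉₊
  have hmD : m ≤ m * D := G.numEdges_le_mul_ceil_dmax
  have hn' : n ≤ n * ψ := Nat.le_mul_of_pos_right _ hψ
  have hψ' : ψ ≤ n * ψ := Nat.le_mul_of_pos_left _ hn
  refine Spec.weaken (c := (n + 3 * m) + ((2 * n + ψ * (1 + (a + 8) * n)) + (2 * n + (2 * n +
    ((2 * (ψ + 1) + 5 * n) + ((2 * n + (3 + 10 * D) * m) + (1 + 2 * n))))))) ?_ ?_ fun _ h => h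
  · unfold fastRound
    refine (Spec_buildReweighted α G).bind fun Gr hGr => ?_
    subst hGr
    have hroot : ∀ u, 9 ≤ 1 / (1 + (G.reweighted α).deg u) * (a : ℝ≥0) := fun u =>
      ha.trans (by gcongr; exact le_rootProb_reweighted hα0 hα1 G u)
    refine (Spec_sample S hroot ψ).bind fun T hT => ?_
    refine Spec.tick_bind ?_
    refine (Spec_findDmax G).bind fun d hd => ?_
    subst hd
    refine (Spec_topNodes hT.le G.dmax).bind fun K hK => ?_
    have htop : IsTopSet G.dmax (etaEst S ψ T.roots) K.toFinset := by
      rw [hK]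
      refine isTopSet_sortedNodes hT.le _ fun u v huv => ?_
      rw [← hT.eta, ← hT.eta]
      gcongr
    have hlen : K.length ≤ D := by
      rw [hK, List.length_reverse, List.length_take]
      exact min_le_left _ _
    have hσ : (fun v => (T.cσ v : ℝ) / (n * ψ)) = sigmaEst ψ T.roots := funext hT.sigma
    have hη : (fun v => (T.cη v : ℝ) / ψ) = etaEst S ψ T.roots := funext hT.eta
    simp only [← hG]
    rw [hσ, hη]
    refine ((Spec_findBest G _ K).weaken (by gcongr) fun _ h => h).bind fun best hbest => ?_
    cases best with
    | none =>
      refine (Spec.ret ?_).weaken (Nat.zero_le _) fun _ h => h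
      refine ⟨_, ⟨hT.length, htop, ?_⟩, rfl, rfl, by simp⟩
      exact Set.eq_empty_of_forall_notMem hbest
    | some c =>
      have hle := G.length_nbrs_le c.1
      refine (Spec.tick_ret ?_).weaken (c := 1 + 2 * (G.nbrs c.1).length) (by omega) fun _ h => h
      exact ⟨_, ⟨hT.length, htop, hbest⟩, rfl, rfl, rfl⟩
  -- Each of `1`, `n`, `ψ` is at most `n * ψ`, and `m ≤ m * D`; 40 is a generous total of the
  -- coefficients.
  · nlinarith

theorem Spec_fast {α : ℝ≥0} (hα0 : 0 < α) (hα1 : α < 1) {a : ℕ} (ha : 9 ≤ α * (a : ℝ≥0))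
    (hn : 0 < n) (G : WDigraph n) (S : Finset (Fin n)) {b ψ : ℕ} (hb : 0 < b) (hψ : 0 < ψ) :
    Spec (fast α G b S ψ) ((a + 42) * (b * (n * ψ + G.numEdges * ⌈G.dmax⌉₊))) fun s =>
      s.trace.length = b ∧ IsGreedyRun α S ψ G s.trace ∧
        s.R = s.trace.filterMap Round.choice := by
  set N := n * ψ + G.numEdges * ⌈G.dmax⌉₊ with hN
  have hN0 : 0 < N := by positivity
  have hbN : b ≤ b * N := Nat.le_mul_of_pos_right _ hN0
  unfold fast
  -- The initial tick and the tick of each round are at most `b * N` each in total, which turns 40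
  -- into 42.
  refine Spec.weaken (c := 1 + b * (1 + (a + 40) * N)) ?_ (by nlinarith) fun _ h => h
  refine Spec.tick_bind ?_
  refine Spec.weaken (Spec.foldlM_const (c := 1 + (a + 40) * N) (fun l (s : FastState n) =>
    s.trace.length = l.length ∧ IsGreedyRun α S ψ G s.trace ∧
      s.R = s.trace.filterMap Round.choice ∧ s.graph = graphAfter G s.trace)
    ⟨rfl, trivial, rfl, rfl⟩ ?_) (by simp) ?_
  · rintro l₁ x l₂ s _ ⟨h1, h2, h3, h4⟩
    have hs := h2.sameDegrees
    rw [← h4] at hs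
    refine Spec.tick_bind ?_
    refine Spec.weaken (Spec_fastRound hα0 hα1 ha hn S hψ s) ?_ ?_
    · rw [hs.numEdges_eq, hs.dmax_eq]
    · rintro s' ⟨r, hr, ht, hg, hR⟩
      refine ⟨by simp [ht, h1], ?_, ?_, ?_⟩
      · rw [ht]
        exact h2.append_singleton (h4 ▸ hr)
      · rw [ht, List.filterMap_append, hR, h3]
        cases hc : r.choice <;> simp [hc]
      · rw [ht, hg, h4]
        simp [graphAfter]
  · rintro s ⟨h1, h2, h3, -⟩
    exact ⟨by simpa using h1, h2, h3⟩

end FastPR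

/-! ### The theorem: choice of the constant and conclusion -/

theorem mainTheorem4 (α : ℝ≥0) (hα0 : 0 < α) (hα1 : α < 1) :
    ∃ C : ℕ, ∀ (n : ℕ) (_ : 0 < n) (G : WDigraph n) (S : Finset (Fin n)) (b : ℕ) (_ : 0 < b)
      (ε δ : ℝ) (_ : 0 < ε) (_ : 0 < δ) (_ : δ < 1) (ψ : ℕ)
      (_ : ψ = ⌈1 / (2 * ε ^ 2) * Real.log (2 / δ)⌉₊),
      (fast α G b S ψ).haltProb = 1 ∧
      (fast α G b S ψ).expectedTime ≤
        ((C * (b * (n * ψ + G.numEdges * ⌈G.dmax⌉₊)) : ℕ) : ℝ≥0∞) ∧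
      ∀ (out : FastState n) (t : ℕ), (fast α G b S ψ).law (out, t) ≠ 0 →
        out.trace.length = b ∧
        IsGreedyRun α S ψ G out.trace ∧
        out.R = out.trace.filterMap Round.choice ∧
        (AlwaysCandidates G out.trace → out.R.length = b) ∧
        ((∃ i, 0 < (G.nbrs i).length ∧ (G.nbrs i).length + 1 < min n ⌈G.dmax⌉₊) →
          out.R.length = b) := by
  obtain ⟨a, ha⟩ := exists_nat_ge (9 / α)
  have ha' : 9 ≤ α * (a : ℝ≥0) := by
    rw [div_le_iff₀ hα0, mul_comm] at ha
    exact ha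
  refine ⟨a + 42, fun n hn G S b hb ε δ hε hδ0 hδ1 ψ hψ => ?_⟩
  have hψ0 : 0 < ψ := by
    rw [hψ, Nat.ceil_pos]
    have : 0 < Real.log (2 / δ) := Real.log_pos (by rw [lt_div_iff₀ hδ0]; linarith)
    positivity
  have h := Spec_fast hα0 hα1 ha' hn G S hb hψ0
  refine ⟨h.halts, ?_, fun out t hout => ?_⟩
  -- Halting almost surely makes the penalty term `0 * ⊤ = 0`.
  · rw [RandTime.expectedTime, h.halts]
    simpa [RandTime.expect] using h.cost
  · obtain ⟨h1, h2, h3⟩ := h.post _ hout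
    have h4 : AlwaysCandidates G out.trace → out.R.length = b := fun hc => by
      rw [h3, h2.length_filterMap hc, h1]
    exact ⟨h1, h2, h3, h4, fun ⟨i, hi0, hi⟩ => h4 (h2.alwaysCandidates hi0 hi)⟩
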